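/- Let $m=2d$ be even, let $\mathfrak F$ be the symmetric Fock space over $L^2(\mathbb R_+,\mathbb C^{d})$, and let $W(t)=(W_1(t),\dots,W_m(t))^{\mathsf T}$, $t\ge 0$, be the $m$-channel quantum Wiener process of self-adjoint operators on $\mathfrak F$, with $W(0)=\mathcal I$ (the vector of $m$ copies of the identity operator) and $$[W(s),W(t)^{\mathsf T}]=2i\min(s,t)J,\qquad J=\begin{bmatrix}0&1\\-1&0\end{bmatrix}\otimes I_{m/2}.$$ Fix $T>0$ and set $$\omega_k=\tfrac{\pi}{T}\left(k+\tfrac12\right),\qquad f_k(t)=\sqrt{\tfrac2T}\,\sin(\omega_k t),\qquad w_k=\omega_k\int_0^T f_k(t)\,(W(t)-\mathcal I)\,dt,\qquad k=0,1,2,\dots$$ Let $\rho$ be a density operator on $\mathfrak F$, write $\mathbf E\,\xi=\operatorname{Tr}(\rho\,\xi)$, and suppose that $W$ is in the vacuum state on $[0,T]$, in the sense that $$\mathbf E\, e^{i\int_0^T f(t)^{\mathsf T}dW(t)}=e^{-\frac12\int_0^T|f(t)|^2dt}\qquad\text{for all } f\in L^2([0,T],\mathbb R^m).$$ Then the vectors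 $w_0,w_1,w_2,\dots$ are statistically independent: the von Neumann algebras $\mathcal A_k$ generated by the operators $e^{iu^{\mathsf T}w_k}$, $u\in\mathbb R^m$, commute with each other, and $\mathbf E(A_0A_1\cdots A_N)=\prod_{k=0}^N\mathbf E A_k$ for all $N\ge 0$ and all $A_k\in\mathcal A_k$. Moreover, for every $N\ge0$ the vectors $w_0,\dots,w_N$ are in a joint Gaussian quantum state with zero mean and covariance matrix $I_{N+1}\otimes\Omega$, where $\Omega=I_m+iJ$; that is, they satisfy the canonical commutation relations $[w_j,w_k^{\mathsf T}]=2i\delta_{jk}J$ in Weyl form and $$\mathbf E\, e^{i\sum_{k=0}^N u_k^{\mathsf T}w_k}=e^{-\frac12\sum_{k=0}^N|u_k|^2}\qquad\text{for all } u_0,\dots,u_N\in\mathbb R^m.$$ In particular, $$\mathbf E\,w_k=0,\qquad \mathbf E(w_jw_k^{\mathsf T})=\delta_{jk}\,\Omega,\qquad j,k=0,1,2,\dots$$ -/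

import Mathlib

open scoped InnerProductSpace Kronecker ComplexOrder
open MeasureTheory

noncomputable section

namespace QKL

/-! ### Unbounded operators and their exponentials -/

section Operators

variable {H : Type} [NormedAddCommGroup H] [InnerProductSpace ℂ H]

/-- A bounded operator regarded as an everywhere defined partial operator. -/
def ofBounded (X : H →L[ℂ] H) : H →ₗ.[ℂ] H :=
  (X : H →ₗ[ℂ] H).toPMap ⊤

/-- The operator product `A B` with its natural domain `{x ∈ dom B | B x ∈ dom A}`. -/
def opMul (A B : H →ₗ.[ℂ] H) : H →ₗ.[ℂ] H where
  domain := (A.domain.comap B.toFun).map B.domain.subtype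
  toFun :=
    { toFun := fun x => A ⟨B ⟨x, by
          obtain ⟨y, -, hy⟩ := x.2
          rw [← hy]; exact y.2⟩, by
          obtain ⟨y, hy, hyx⟩ := x.2
          have h : (⟨(x : H), by rw [← hyx]; exact y.2⟩ : B.domain) = y :=
            Subtype.ext hyx.symm
          rw [h]
          exact hy⟩
      map_add' := fun x y => by
        rw [← A.map_add]
        congr 1
        apply Subtype.ext
        change B _ = B _ + B _
        rw [← B.map_add]
        rfl
      map_smul' := fun c x => by
        rw [RingHom.id_apply, ← A.map_smul]
        congr 1
        apply Subtype.ext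
        change B _ = c • B _
        rw [← B.map_smul]
        rfl }

/-- Strongly continuous one-parameter unitary groups. -/
structure IsUnitaryGroup (U : ℝ → H →L[ℂ] H) : Prop where
  zero : U 0 = 1
  add : ∀ s t, U (s + t) = U s * U t
  norm_map : ∀ s x, ‖U s x‖ = ‖x‖
  continuous : ∀ x, Continuous fun s => U s x

/-- The (Stone) generator `A` of `U s = exp (i s A)`: the domain consists of the vectors whose
orbit is differentiable at `0`, and `A x = -i (d/ds) U s x` at `s = 0`. -/
def generator (U : ℝ → H →L[ℂ] H) : H →ₗ.[ℂ] H where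
  domain :=
    { carrier := {x | DifferentiableAt ℝ (fun s => U s x) 0}
      add_mem' := fun {x y} hx hy => by
        have h := DifferentiableAt.fun_add hx hy
        simpa only [Set.mem_ofPred_eq, map_add] using h
      zero_mem' := by simp
      smul_mem' := fun c x hx => by
        have h := DifferentiableAt.fun_const_smul hx c
        simpa only [Set.mem_ofPred_eq, map_smul] using h }
  toFun :=
    { toFun := fun x => (-Complex.I) • deriv (fun s => U s (x : H)) 0
      map_add' := fun x y => by
        have h := deriv_fun_add (f := fun s => U s (x : H)) (g := fun s => U s (y : H)) (x := 0)
          x.2 y.2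
        simp only [Submodule.coe_add, map_add, h, smul_add]
      map_smul' := fun c x => by
        have h := deriv_fun_const_smul (f := fun s => U s (x : H)) (x := 0) c x.2
        simp only [SetLike.val_smul, map_smul, h, RingHom.id_apply]
        rw [smul_comm] }

open Classical in
/-- `exp (i A)` for a self-adjoint operator `A`, that is, for the generator of a (unique) strongly
continuous unitary group. It is set to `0` for an operator that is not of this kind. -/
def expI (A : H →ₗ.[ℂ] H) : H →L[ℂ] H :=
  if h : ∃ U : ℝ → H →L[ℂ] H, IsUnitaryGroup U ∧ generator U = A then h.choose 1 else 0

/-- The real linear combination `∑ a, u a ξ a` of finitely many self-adjoint operators: the closure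
of the sum on the intersection of the domains. -/
def linComb {ι : Type} [Fintype ι] (u : ι → ℝ) (ξ : ι → H →ₗ.[ℂ] H) : H →ₗ.[ℂ] H :=
  (∑ a, (u a : ℂ) • ξ a).closure

open Classical in
/-- `A x`, extended by `0` outside of the domain of `A`. -/
def applyOrZero (A : H →ₗ.[ℂ] H) (x : H) : H :=
  if h : x ∈ A.domain then A ⟨x, h⟩ else 0

lemma applyOrZero_add (A : H →ₗ.[ℂ] H) {x y : H} (hx : x ∈ A.domain) (hy : y ∈ A.domain) :
    applyOrZero A (x + y) = applyOrZero A x + applyOrZero A y := by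
  simp only [applyOrZero, hx, hy, A.domain.add_mem hx hy, dif_pos]
  rw [← A.map_add]
  rfl

lemma applyOrZero_smul (A : H →ₗ.[ℂ] H) (c : ℂ) {x : H} (hx : x ∈ A.domain) :
    applyOrZero A (c • x) = c • applyOrZero A x := by
  simp only [applyOrZero, hx, A.domain.smul_mem c hx, dif_pos]
  rw [← A.map_smul]
  rfl

/-- The strong integral `∫ t in 0..T, φ t A t` of an operator-valued function, initially defined on
the vectors `x` which lie in the domain of every `A t`, `0 ≤ t ≤ T`, and for which
`t ↦ φ t A t x` is (Bochner) integrable; the operator is then the closure. -/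
def strongIntegral (T : ℝ) (φ : ℝ → ℝ) (A : ℝ → H →ₗ.[ℂ] H) : H →ₗ.[ℂ] H :=
  LinearPMap.closure
  { domain :=
      { carrier := {x | (∀ t ∈ Set.Icc 0 T, x ∈ (A t).domain) ∧
          IntegrableOn (fun t => φ t • applyOrZero (A t) x) (Set.Icc 0 T)}
        add_mem' := fun {x y} hx hy => by
          refine ⟨fun t ht => (A t).domain.add_mem (hx.1 t ht) (hy.1 t ht), ?_⟩
          refine (hx.2.add hy.2).congr_fun (fun t ht => ?_) measurableSet_Icc
          simp only [Pi.add_apply, applyOrZero_add (A t) (hx.1 t ht) (hy.1 t ht), smul_add]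
        zero_mem' := by
          refine ⟨fun t _ => (A t).domain.zero_mem, ?_⟩
          have h : (fun t => φ t • applyOrZero (A t) (0 : H)) = fun _ => 0 := by
            funext t
            have h0 := applyOrZero_smul (A t) 0 (A t).domain.zero_mem
            simp only [zero_smul] at h0
            simp [h0]
          rw [h]
          exact integrableOn_zero
        smul_mem' := fun c x hx => by
          refine ⟨fun t ht => (A t).domain.smul_mem c (hx.1 t ht), ?_⟩
          have h := Integrable.smul c hx.2
          refine IntegrableOn.congr_fun h (fun t ht => ?_) measurableSet_Icc
          simp only [Pi.smul_apply, applyOrZero_smul (A t) c (hx.1 t ht)]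
          rw [smul_comm] }
    toFun :=
      { toFun := fun x => ∫ t in Set.Icc 0 T, φ t • applyOrZero (A t) (x : H)
        map_add' := fun x y => by
          rw [← integral_add x.2.2 y.2.2]
          refine setIntegral_congr_fun measurableSet_Icc (fun t ht => ?_)
          simp only [Submodule.coe_add, applyOrZero_add (A t) (x.2.1 t ht) (y.2.1 t ht), smul_add]
        map_smul' := fun c x => by
          rw [RingHom.id_apply, ← integral_smul]
          refine setIntegral_congr_fun measurableSet_Icc (fun t ht => ?_)
          simp only [SetLike.val_smul, applyOrZero_smul (A t) c (x.2.1 t ht)]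
          rw [smul_comm] } }

/-! ### Quantum states and expectations -/

/-- `Tr (ξ ρ) = c` for a bounded operator `ρ` with range in the domain of `ξ`: the diagonal series
of `ξ ρ` converges to `c` unconditionally in every orthonormal basis. -/
def HasExpectation (ρ : H →L[ℂ] H) (ξ : H →ₗ.[ℂ] H) (c : ℂ) : Prop :=
  ∃ hρ : ∀ x, ρ x ∈ ξ.domain, ∀ (ι : Type) (b : HilbertBasis ι ℂ H),
    HasSum (fun i => ⟪b i, ξ ⟨ρ (b i), hρ (b i)⟩⟫_ℂ) c

/-- Density operators: positive operators of trace one. -/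
structure IsDensityOperator [CompleteSpace H] (ρ : H →L[ℂ] H) : Prop where
  isPositive : ρ.IsPositive
  trace_eq_one : HasExpectation ρ (ofBounded 1) 1

/-- The quantum variables `ξ a` are in a joint Gaussian state with mean vector `μ` and (complex,
Hermitian) covariance matrix `Γ`: they satisfy the Weyl form of the canonical commutation relations
`[ξ a, ξ b] = 2 i Im (Γ a b)`, and their joint quasi-characteristic function is
`exp (i uᵀ μ - uᵀ Γ u / 2)`. -/
structure IsJointlyGaussian {ι : Type} [Fintype ι] (ρ : H →L[ℂ] H) (ξ : ι → H →ₗ.[ℂ] H)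
    (μ : ι → ℝ) (Γ : Matrix ι ι ℂ) : Prop where
  weyl_ccr : ∀ u v : ι → ℝ, expI (linComb u ξ) * expI (linComb v ξ) =
    Complex.exp (-Complex.I * ∑ a, ∑ b, (u a : ℂ) * ((Γ a b).im : ℂ) * (v b : ℂ)) •
      expI (linComb (u + v) ξ)
  qcf : ∀ u : ι → ℝ, HasExpectation ρ (ofBounded (expI (linComb u ξ)))
    (Complex.exp (Complex.I * (∑ a, (u a : ℂ) * (μ a : ℂ)) -
      1 / 2 * ∑ a, ∑ b, (u a : ℂ) * Γ a b * (u b : ℂ)))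

/-- The von Neumann algebra (bicommutant) generated by the unitary operators `exp (i uᵀ ξ)`. -/
def generatedAlgebra {ι : Type} [Fintype ι] (ξ : ι → H →ₗ.[ℂ] H) : Set (H →L[ℂ] H) :=
  Set.centralizer (Set.centralizer (Set.range fun u : ι → ℝ => expI (linComb u ξ)))

/-- Statistical independence of a sequence of vectors of quantum variables: the generated
von Neumann algebras commute pairwise, and the state factorizes over them. -/
def StatIndependent {ι : Type} [Fintype ι] (ρ : H →L[ℂ] H) (ξ : ℕ → ι → H →ₗ.[ℂ] H) : Prop :=
  (∀ j k, j ≠ k → ∀ A ∈ generatedAlgebra (ξ j), ∀ B ∈ generatedAlgebra (ξ k), A * B = B * A) ∧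
  ∀ (N : ℕ) (A : ℕ → H →L[ℂ] H), (∀ k, A k ∈ generatedAlgebra (ξ k)) →
    ∃ c : ℕ → ℂ, (∀ k, HasExpectation ρ (ofBounded (A k)) (c k)) ∧
      HasExpectation ρ (ofBounded ((List.range N).map A).prod) (∏ k ∈ Finset.range N, c k)

end Operators

/-! ### The symmetric Fock space through exponential vectors -/

section FockSpace

/-- The kernel `(u, v) ↦ exp ⟪u, v⟫`. -/
def expKernel (K : Type) [NormedAddCommGroup K] [InnerProductSpace ℂ K] :
    Matrix K K (ℂ →L[ℂ] ℂ) :=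
  Matrix.of fun u v => Complex.exp ⟪u, v⟫_ℂ • (1 : ℂ →L[ℂ] ℂ)

variable {K : Type} [NormedAddCommGroup K] [InnerProductSpace ℂ K]

lemma posSemidef_exp_inner {ι : Type} (x : ι → K) :
    (Matrix.of fun i j => Complex.exp ⟪x i, x j⟫_ℂ).PosSemidef := by
  have hg : (Matrix.of fun i j => ⟪x i, x j⟫_ℂ).PosSemidef := by
    refine ⟨?_, fun f => ?_⟩
    · ext i j
      simp
    · have h : (f.sum fun i xi => f.sum fun j xj =>
          star xi * (Matrix.of fun i j => ⟪x i, x j⟫_ℂ) i j * xj) =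
          ⟪(f.sum fun i xi => xi • x i : K), (f.sum fun i xi => xi • x i : K)⟫_ℂ := by
        simp only [Finsupp.sum, Matrix.of_apply]
        rw [sum_inner]
        refine Finset.sum_congr rfl fun i _ => ?_
        rw [inner_sum]
        refine Finset.sum_congr rfl fun j _ => ?_
        rw [inner_smul_left, inner_smul_right, RCLike.star_def]
        ring
      rw [h, inner_self_eq_norm_sq_to_K]
      positivity
  have hp : ∀ n : ℕ, (Matrix.of fun i j => ⟪x i, x j⟫_ℂ ^ n).PosSemidef := by
    intro n
    induction n with
    | zero =>
      refine ⟨?_, fun f => ?_⟩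
      · ext i j
        simp
      · have h : (f.sum fun i xi => f.sum fun j xj =>
            star xi * (Matrix.of fun i j => ⟪x i, x j⟫_ℂ ^ 0) i j * xj) =
            star (f.sum fun _ xi => xi) * (f.sum fun _ xi => xi) := by
          simp only [Finsupp.sum, pow_zero, Matrix.of_apply, star_sum, Finset.sum_mul_sum, mul_one]
        rw [h]
        exact star_mul_self_nonneg _
    | succ n ih => exact ih.hadamard hg
  refine ⟨?_, fun f => ?_⟩
  · ext i j
    simp [← Complex.exp_conj]
  · have hs : HasSum (fun n : ℕ => (n.factorial : ℂ)⁻¹ * f.sum fun i xi => f.sum fun j xj =>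
        star xi * ⟪x i, x j⟫_ℂ ^ n * xj)
        (f.sum fun i xi => f.sum fun j xj => star xi * Complex.exp ⟪x i, x j⟫_ℂ * xj) := by
      simp only [Finsupp.sum, Finset.mul_sum]
      refine hasSum_sum fun i _ => hasSum_sum fun j _ => ?_
      have h := NormedSpace.expSeries_div_hasSum_exp (𝔸 := ℂ) ⟪x i, x j⟫_ℂ
      rw [← Complex.exp_eq_exp_ℂ] at h
      have e : (fun n : ℕ => (n.factorial : ℂ)⁻¹ * (star (f i) * ⟪x i, x j⟫_ℂ ^ n * f j)) =
          fun n : ℕ => star (f i) * (⟪x i, x j⟫_ℂ ^ n / (n.factorial : ℂ)) * f j := by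
        funext n
        rw [div_eq_mul_inv]
        ring
      rw [e]
      exact (h.mul_left (star (f i))).mul_right (f j)
    exact hs.nonneg fun n => mul_nonneg (by positivity) ((hp n).2 f)

instance instFactExpKernel : Fact (expKernel K).PosSemidef := by
  constructor
  have hK : (expKernel K).IsHermitian := by
    ext1 u v
    simp only [Matrix.conjTranspose_apply, expKernel, Matrix.of_apply, star_smul, star_one,
      RCLike.star_def, ← Complex.exp_conj, inner_conj_symm]
  have h := (RKHS.posSemidef_tfae (K := expKernel K)).out 0 2
  refine h.mpr ⟨hK, fun f => ?_⟩
  have h1 := (posSemidef_exp_inner (K := K) id).2 f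
  have h2 := (RCLike.nonneg_iff.mp h1).1
  convert h2 using 2
  refine Finsupp.sum_congr fun u _ => Finsupp.sum_congr fun v _ => ?_
  simp only [expKernel, Matrix.of_apply, smul_apply, id, RCLike.star_def, RCLike.inner_apply,
    one_apply_eq_self, smul_eq_mul, map_mul, ← Complex.exp_conj, inner_conj_symm]
  ring

variable (K) in
/-- The symmetric Fock space over `K`: the Hilbert space generated by the exponential vectors
`expVec u`, `u ∈ K`, with `⟪expVec u, expVec v⟫ = exp ⟪u, v⟫`. -/
abbrev Fock : Type := RKHS.OfKernel (expKernel K)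

/-- Exponential (coherent) vectors. -/
def expVec (u : K) : Fock K := RKHS.kerFun (Fock K) u 1

lemma inner_expVec (u v : K) : ⟪expVec u, expVec v⟫_ℂ = Complex.exp ⟪u, v⟫_ℂ := by
  have h := RKHS.kernel_inner (Fock K) v u 1 1
  rw [expVec, expVec, ← h, RKHS.OfKernel.kernel_ofKernel]
  simp [expKernel, ← Complex.exp_conj]

lemma denseRange_expVec :
    DenseRange (Finsupp.linearCombination ℂ (expVec : K → Fock K)) := by
  have h := RKHS.kerFun_dense (Fock K)
  have e : Submodule.span ℂ {RKHS.kerFun (Fock K) x v | (x) (v)} =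
      LinearMap.range (Finsupp.linearCombination ℂ (expVec : K → Fock K)) := by
    rw [Finsupp.range_linearCombination]
    apply le_antisymm
    · refine Submodule.span_le.mpr ?_
      rintro _ ⟨x, v, rfl⟩
      have hv : RKHS.kerFun (Fock K) x v = v • expVec x := by
        rw [expVec, ← map_smul, smul_eq_mul, mul_one]
      rw [hv]
      exact Submodule.smul_mem _ _ (Submodule.subset_span ⟨x, rfl⟩)
    · refine Submodule.span_mono ?_
      rintro _ ⟨x, rfl⟩
      exact ⟨x, 1, rfl⟩
  rw [e] at h
  rw [DenseRange, dense_iff_closure_eq]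
  have h2 := congrArg (fun S : Submodule ℂ (Fock K) => (S : Set (Fock K))) h
  simpa only [LinearMap.coe_range, Submodule.topologicalClosure_coe, Submodule.top_coe] using h2

/-- The image of `expVec v` under the Weyl operator `W(u)`. -/
def weylVec (u v : K) : Fock K :=
  Complex.exp (-(‖u‖ ^ 2 : ℝ) / 2 - ⟪u, v⟫_ℂ) • expVec (u + v)

lemma inner_weylVec (u v w : K) :
    ⟪weylVec u v, weylVec u w⟫_ℂ = ⟪expVec v, expVec w⟫_ℂ := by
  simp only [weylVec, inner_smul_left, inner_smul_right, inner_expVec, ← Complex.exp_conj,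
    ← Complex.exp_add, inner_add_left, inner_add_right]
  congr 1
  have h : ⟪u, u⟫_ℂ = ((‖u‖ ^ 2 : ℝ) : ℂ) := by
    rw [inner_self_eq_norm_sq_to_K]
    norm_cast
  simp only [map_sub, map_neg, map_div₀, Complex.conj_ofReal, inner_conj_symm, h, map_ofNat]
  ring

lemma norm_linearCombination_weylVec (u : K) (f : K →₀ ℂ) :
    ‖Finsupp.linearCombination ℂ (weylVec u) f‖ =
      ‖Finsupp.linearCombination ℂ (expVec : K → Fock K) f‖ := by
  have h : ⟪Finsupp.linearCombination ℂ (weylVec u) f,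
      Finsupp.linearCombination ℂ (weylVec u) f⟫_ℂ =
      ⟪Finsupp.linearCombination ℂ (expVec : K → Fock K) f,
        Finsupp.linearCombination ℂ (expVec : K → Fock K) f⟫_ℂ := by
    simp only [Finsupp.linearCombination_apply, Finsupp.sum, sum_inner, inner_sum,
      inner_smul_left, inner_smul_right, inner_weylVec]
  rw [← sq_eq_sq₀ (norm_nonneg _) (norm_nonneg _), ← inner_self_eq_norm_sq (𝕜 := ℂ), h,
    inner_self_eq_norm_sq (𝕜 := ℂ)]

/-- The Weyl (displacement) operator, determined by its action on the exponential vectors: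
`W(u) expVec v = exp (-‖u‖² / 2 - ⟪u, v⟫) expVec (u + v)`. -/
def weyl (u : K) : Fock K →L[ℂ] Fock K :=
  (Finsupp.linearCombination ℂ (weylVec u)).extendOfNorm
    (Finsupp.linearCombination ℂ (expVec : K → Fock K))

lemma weyl_expVec (u v : K) :
    weyl u (expVec v) = Complex.exp (-(‖u‖ ^ 2 : ℝ) / 2 - ⟪u, v⟫_ℂ) • expVec (u + v) := by
  have h := LinearMap.extendOfNorm_eq (f := Finsupp.linearCombination ℂ (weylVec u))
    (e := Finsupp.linearCombination ℂ (expVec : K → Fock K)) denseRange_expVec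
    ⟨1, fun f => by rw [one_mul, norm_linearCombination_weylVec]⟩ (Finsupp.single v 1)
  rw [Finsupp.linearCombination_single, Finsupp.linearCombination_single, one_smul, one_smul] at h
  exact h

/-- The field operator `a(h) + a(h)*`, the self-adjoint operator with
`exp (i s (a(h) + a(h)*)) = W(i s h)`. -/
def fieldOp (h : K) : Fock K →ₗ.[ℂ] Fock K :=
  generator fun s => weyl (((s : ℂ) * Complex.I) • h)

end FockSpace

/-! ### The quantum Wiener process and its Karhunen-Loeve coefficients

The number of channels is `m = 2 d`. The channels are indexed by `Fin 2 × Fin d`: `(0, j)` are the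
position-type and `(1, j)` the momentum-type components. -/

section Wiener

/-- The matrix `[0, 1; -1, 0]`. -/
def bJ : Matrix (Fin 2) (Fin 2) ℝ := !![0, 1; -1, 0]

/-- The matrix `J = bJ ⊗ I`. -/
def J (d : ℕ) : Matrix (Fin 2 × Fin d) (Fin 2 × Fin d) ℝ :=
  bJ ⊗ₖ (1 : Matrix (Fin d) (Fin d) ℝ)

/-- The quantum Ito matrix `Ω = I + i J`. -/
def Omega (d : ℕ) : Matrix (Fin 2 × Fin d) (Fin 2 × Fin d) ℂ :=
  1 + Complex.I • (J d).map Complex.ofReal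

/-- The one-particle space `L²(ℝ₊, ℂᵈ)`. -/
abbrev OneParticle (d : ℕ) : Type :=
  Lp (EuclideanSpace ℂ (Fin d)) 2 (volume.restrict (Set.Ici (0 : ℝ)))

/-- The symmetric Fock space of `d` boson fields over the time half-line. -/
abbrev FieldSpace (d : ℕ) : Type := Fock (OneParticle d)

/-- The complex form of a vector in `ℝᵐ`, `m = 2 d`: with entries `f (0, j) + i f (1, j)`. -/
def complexForm {d : ℕ} (x : EuclideanSpace ℝ (Fin 2 × Fin d)) : EuclideanSpace ℂ (Fin d) :=
  WithLp.toLp 2 fun j => (x (0, j) : ℂ) + Complex.I * (x (1, j) : ℂ)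

open Classical in
/-- The one-particle vector of a square integrable function on the half-line with values
in `ℝᵐ` (and `0` if the function is not square integrable). -/
def testVec {d : ℕ} (f : ℝ → EuclideanSpace ℝ (Fin 2 × Fin d)) : OneParticle d :=
  if h : MemLp (fun t => complexForm (f t)) 2 (volume.restrict (Set.Ici (0 : ℝ))) then
    h.toLp else 0

/-- The quantum stochastic integral `∫ t in 0..T, (f t)ᵀ dW t` of a deterministic square integrable
function: the field operator of `f` on `[0, T]`. Its position-type components contribute
`A + A*` and its momentum-type components `i (A* - A)`, where `A`, `A*` are the annihilation and
creation processes. -/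
def wienerIntegral {d : ℕ} (T : ℝ) (f : ℝ → EuclideanSpace ℝ (Fin 2 × Fin d)) :
    FieldSpace d →ₗ.[ℂ] FieldSpace d :=
  fieldOp (testVec ((Set.Icc 0 T).indicator f))

/-- The identity operator. -/
def idOp (d : ℕ) : FieldSpace d →ₗ.[ℂ] FieldSpace d := ofBounded 1

/-- The component `W_a(t)`, `t ≥ 0`, of the quantum Wiener process, which starts at the identity
operator: `W_a(t) - I` is the field operator of the function `s ↦ e_a` on `[0, t]`. -/
def W {d : ℕ} (a : Fin 2 × Fin d) (t : ℝ) : FieldSpace d →ₗ.[ℂ] FieldSpace d :=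
  idOp d + wienerIntegral t fun _ => EuclideanSpace.single a (1 : ℝ)

/-- The quantum Wiener process is in the vacuum state on `[0, T]`: its quasi-characteristic
functional is `exp (-‖f‖² / 2)`. -/
def IsVacuum {d : ℕ} (T : ℝ) (ρ : FieldSpace d →L[ℂ] FieldSpace d) : Prop :=
  ∀ f : ℝ → EuclideanSpace ℝ (Fin 2 × Fin d), MemLp f 2 (volume.restrict (Set.Icc 0 T)) →
    HasExpectation ρ (ofBounded (expI (wienerIntegral T f)))
      (Complex.exp (-(1 / 2) * ((∫ t in Set.Icc 0 T, ‖f t‖ ^ 2 : ℝ) : ℂ)))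

/-- The frequencies `ω_k = (π / T) (k + 1/2)`. -/
def omega (T : ℝ) (k : ℕ) : ℝ := Real.pi / T * (k + 1 / 2)

/-- The eigenfunctions `f_k(t) = √(2 / T) sin (ω_k t)`. -/
def eigenfun (T : ℝ) (k : ℕ) (t : ℝ) : ℝ := √(2 / T) * Real.sin (omega T k * t)

/-- The Karhunen-Loeve coefficients `w_k = ω_k ∫ t in 0..T, f_k(t) (W(t) - I)`, componentwise. -/
def klCoeff {d : ℕ} (T : ℝ) (k : ℕ) (a : Fin 2 × Fin d) : FieldSpace d →ₗ.[ℂ] FieldSpace d :=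
  (omega T k : ℂ) • strongIntegral T (eigenfun T k) fun t => W a t - idOp d

end Wiener

end QKL

end

/-! Integrating by parts turns `w_k` into the field operator of `√(2 / T) cos (ω_k t) e_a` on
`[0, T]`, because `W_a(t) - I` is the field operator of `e_a` on `[0, t]`. These one-particle
vectors have inner products `δ_jk Ω_ab`, so everything reduces to field operators of a vacuum state.

Purify the density operator `ρ` to a unit vector `ψ` of a Hilbert sum of copies of the Fock space.
The quasi-characteristic functional determines the inner products of the coherent vectors
`W(u) ψ`: they are those of the coherent vectors of the Fock vacuum. Hence they span a copy of a
Fock space with vacuum vector `ψ`, on which the field operators act in the usual way, and the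
expectations are computed in the Fock vacuum. For orthogonal subspaces the Weyl operators commute
and their expectations factorize. The factorization passes to the generated von Neumann algebras
because, by the density part of the bicommutant theorem, `A ψ` is a limit of combinations of vectors
`W(u) ψ` for every element `A` of such an algebra. -/

open scoped InnerProductSpace Kronecker ComplexOrder
open MeasureTheory
open Complex (I)

noncomputable section

namespace QKL

/-! ### Partial operators -/

section PartialOperators

variable {H : Type} [NormedAddCommGroup H] [InnerProductSpace ℂ H]

lemma mem_opMul_graph {A B : H →ₗ.[ℂ] H} {x y z : H} (hxy : (x, y) ∈ B.graph)
    (hyz : (y, z) ∈ A.graph) : (x, z) ∈ (opMul A B).graph := by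
  obtain ⟨x, rfl, rfl⟩ := (LinearPMap.mem_graph_iff _).mp hxy
  obtain ⟨⟨y, hy⟩, hBx, rfl⟩ := (LinearPMap.mem_graph_iff _).mp hyz
  obtain rfl : y = B x := hBx
  exact (LinearPMap.mem_graph_iff _).mpr ⟨⟨x, x, hy, rfl⟩, rfl, rfl⟩

lemma ofBounded_add_sub_ofBounded (X : H →L[ℂ] H) (A : H →ₗ.[ℂ] H) :
    ofBounded X + A - ofBounded X = A := by
  refine LinearPMap.ext ?_ fun x hx hx' => ?_
  · ext x
    simp [ofBounded, LinearPMap.sub_domain, LinearPMap.add_domain]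
  · change X x + A ⟨x, hx'⟩ - X x = A ⟨x, hx'⟩
    exact add_sub_cancel_left _ _

/-- `z` is the value at `x` of the adjoint of the restriction of `A` to `S`: the weak form of
`z = A x`, tested against the vectors of `S`, for a symmetric operator `A`. -/
def IsWeakValueOn (A : H →ₗ.[ℂ] H) (S : Set H) (x z : H) : Prop :=
  ∀ y ∈ S, ∀ w, (y, w) ∈ A.graph → ⟪w, x⟫_ℂ = ⟪y, z⟫_ℂ

lemma IsWeakValueOn.span {A : H →ₗ.[ℂ] H} {S : Set H} {x z : H} (h : IsWeakValueOn A S x z)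
    (hS : S ⊆ A.domain) : IsWeakValueOn A (Submodule.span ℂ S) x z := by
  have exists_value : ∀ y ∈ Submodule.span ℂ S, ∃ w, (y, w) ∈ A.graph ∧ ⟪w, x⟫_ℂ = ⟪y, z⟫_ℂ := by
    intro y hy
    induction hy using Submodule.span_induction with
    | mem y hy =>
      obtain ⟨w, hw⟩ := LinearPMap.mem_domain_iff.mp (hS hy)
      exact ⟨w, hw, h y hy w hw⟩
    | zero => exact ⟨0, A.graph.zero_mem, by simp⟩
    | add y₁ y₂ _ _ ih₁ ih₂ =>
      obtain ⟨w₁, hw₁, h₁⟩ := ih₁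
      obtain ⟨w₂, hw₂, h₂⟩ := ih₂
      exact ⟨w₁ + w₂, A.graph.add_mem hw₁ hw₂, by simp only [inner_add_left, h₁, h₂]⟩
    | smul c y _ ih =>
      obtain ⟨w, hw, h⟩ := ih
      exact ⟨c • w, A.graph.smul_mem c hw, by simp only [inner_smul_left, h]⟩
  intro y hy w hw
  obtain ⟨w', hw', h'⟩ := exists_value y hy
  rwa [A.mem_graph_snd_inj hw hw' rfl]

lemma mem_topologicalClosure_of_forall_inner [CompleteSpace H] {G : Submodule ℂ (H × H)} {x z : H}
    (h : ∀ p q : H, (∀ y w, (y, w) ∈ G → ⟪p, y⟫_ℂ + ⟪q, w⟫_ℂ = 0) → ⟪p, x⟫_ℂ + ⟪q, z⟫_ℂ = 0) :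
    (x, z) ∈ G.topologicalClosure := by
  let e := WithLp.prodContinuousLinearEquiv 2 ℂ H H
  let G₂ : Submodule ℂ (WithLp 2 (H × H)) := G.comap (e : WithLp 2 (H × H) →ₗ[ℂ] H × H)
  have mem_bipolar : e.symm (x, z) ∈ G₂ᗮᗮ := by
    intro pq hpq
    have annihilates : ∀ y w, (y, w) ∈ G → ⟪pq.fst, y⟫_ℂ + ⟪pq.snd, w⟫_ℂ = 0 := by
      intro y w hyw
      have h₀ := congrArg (starRingEnd ℂ) (hpq (e.symm (y, w)) (by simpa [G₂] using hyw))
      simpa [WithLp.prod_inner_apply, e] using h₀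
    simpa [WithLp.prod_inner_apply, e] using h pq.fst pq.snd annihilates
  rw [Submodule.orthogonal_orthogonal_eq_closure] at mem_bipolar
  have mapsTo : Set.MapsTo e (G₂ : Set (WithLp 2 (H × H))) (G : Set (H × H)) := fun g hg => hg
  exact mapsTo.closure e.continuous mem_bipolar

end PartialOperators

/-! ### Unitary groups and their generators -/

section UnitaryGroups

variable {H : Type} [NormedAddCommGroup H] [InnerProductSpace ℂ H] {U V : ℝ → H →L[ℂ] H}

lemma mem_generator_graph {x z : H} :
    (x, z) ∈ (generator U).graph ↔ HasDerivAt (fun s => U s x) (I • z) 0 := by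
  rw [LinearPMap.mem_graph_iff]
  constructor
  · rintro ⟨⟨y, hy⟩, rfl, hz⟩
    obtain rfl : (-I) • deriv (fun s => U s y) 0 = z := hz
    simpa [smul_smul] using DifferentiableAt.hasDerivAt hy
  · intro h
    refine ⟨⟨x, h.differentiableAt⟩, rfl, ?_⟩
    change (-I) • deriv (fun s => U s x) 0 = z
    simp [h.deriv, smul_smul]

lemma continuous_apply_of_dense_span {X : Type*} [TopologicalSpace X] {F : X → H →L[ℂ] H}
    (norm_map : ∀ s x, ‖F s x‖ = ‖x‖) {S : Set H} (hS : Dense (Submodule.span ℂ S : Set H))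
    (h : ∀ x ∈ S, Continuous fun s => F s x) (x : H) : Continuous fun s => F s x := by
  have continuous_of_mem_span : ∀ y ∈ Submodule.span ℂ S, Continuous fun s => F s y := by
    intro y hy
    induction hy using Submodule.span_induction with
    | mem y hy => exact h y hy
    | zero => simpa only [map_zero] using continuous_const
    | add y₁ y₂ _ _ ih₁ ih₂ => simpa only [map_add] using Continuous.fun_add ih₁ ih₂
    | smul c y _ ih => simpa only [map_smul] using Continuous.fun_const_smul ih c
  refine continuous_of_uniform_approx_of_continuous fun u hu => ?_
  obtain ⟨ε, hε, hu⟩ := Metric.mem_uniformity_dist.mp hu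
  obtain ⟨y, hy, hxy⟩ := hS.exists_dist_lt x hε
  refine ⟨_, continuous_of_mem_span y hy, fun s => hu ?_⟩
  rwa [dist_eq_norm, ← map_sub, norm_map, ← dist_eq_norm]

namespace IsUnitaryGroup

variable (hU : IsUnitaryGroup U)

include hU

lemma inner_map_map (s : ℝ) (x y : H) : ⟪U s x, U s y⟫_ℂ = ⟪x, y⟫_ℂ :=
  LinearIsometry.inner_map_map (⟨(U s : H →ₗ[ℂ] H), hU.norm_map s⟩ : H →ₗᵢ[ℂ] H) x y

lemma apply_add (s t : ℝ) (x : H) : U (s + t) x = U s (U t x) := by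
  rw [hU.add]; rfl

lemma apply_comm (s t : ℝ) (x : H) : U s (U t x) = U t (U s x) := by
  rw [← hU.apply_add, ← hU.apply_add, add_comm]

lemma apply_zero (x : H) : U 0 x = x := by
  rw [hU.zero]; rfl

lemma apply_neg_apply (s : ℝ) (x : H) : U s (U (-s) x) = x := by
  rw [← hU.apply_add, add_neg_cancel, hU.apply_zero]

lemma inner_map_left (s : ℝ) (x y : H) : ⟪U s x, y⟫_ℂ = ⟪x, U (-s) y⟫_ℂ := by
  rw [← hU.inner_map_map s x, hU.apply_neg_apply]

lemma mem_graph_map {x z : H} (h : (x, z) ∈ (generator U).graph) (s : ℝ) :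
    (U s x, U s z) ∈ (generator U).graph := by
  rw [mem_generator_graph] at h ⊢
  have hasDerivAt_comp := ((U s).restrictScalars ℝ).hasFDerivAt.comp_hasDerivAt 0 h
  simpa [Function.comp_def, hU.apply_comm _ s] using hasDerivAt_comp

lemma hasDerivAt {x z : H} (h : (x, z) ∈ (generator U).graph) (s : ℝ) :
    HasDerivAt (fun r => U r x) (I • U s z) s := by
  have hasDerivAt_zero : HasDerivAt (fun r => U r (U s x)) (I • U s z) (s - s) := by
    simpa using mem_generator_graph.mp (hU.mem_graph_map h s)
  simpa [← hU.apply_add] using hasDerivAt_zero.comp_sub_const s s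

lemma inner_graph {x z y w : H} (hxz : (x, z) ∈ (generator U).graph)
    (hyw : (y, w) ∈ (generator U).graph) : ⟪w, x⟫_ℂ = ⟪y, z⟫_ℂ := by
  have hasDerivAt_inner := (hU.hasDerivAt hyw 0).inner ℂ (hU.hasDerivAt hxz 0)
  simp only [hU.inner_map_map, hU.apply_zero] at hasDerivAt_inner
  have derivative_eq_zero := hasDerivAt_inner.unique (hasDerivAt_const (0 : ℝ) _)
  rw [inner_smul_left, inner_smul_right, Complex.conj_I] at derivative_eq_zero
  refine mul_left_cancel₀ Complex.I_ne_zero ?_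
  linear_combination -derivative_eq_zero

lemma eq_of_generator_eq (hV : IsUnitaryGroup V) (hd : Dense ((generator U).domain : Set H))
    (h : generator U = generator V) : U = V := by
  funext s
  refine ContinuousLinearMap.coeFn_injective (Continuous.ext_on hd (U s).continuous
    (V s).continuous fun x hx => ?_)
  obtain ⟨z, hzU⟩ := LinearPMap.mem_domain_iff.mp hx
  have hzV : (x, z) ∈ (generator V).graph := h ▸ hzU
  have hasDerivAt_inner : ∀ r : ℝ, HasDerivAt (fun r => ⟪U r x, V r x⟫_ℂ) 0 r := by
    intro r
    have symm : ⟪V r z, U r x⟫_ℂ = ⟪V r x, U r z⟫_ℂ :=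
      hU.inner_graph (hU.mem_graph_map hzU r) (h ▸ hV.mem_graph_map hzV r)
    have symm_conj : ⟪U r x, V r z⟫_ℂ = ⟪U r z, V r x⟫_ℂ := by
      simpa only [inner_conj_symm] using congrArg (starRingEnd ℂ) symm
    refine ((hU.hasDerivAt hzU r).inner ℂ (hV.hasDerivAt hzV r)).congr_deriv ?_
    rw [inner_smul_left, inner_smul_right, symm_conj, Complex.conj_I]
    ring
  have inner_eq : ⟪U s x, V s x⟫_ℂ = ⟪x, x⟫_ℂ := by
    simpa only [hU.apply_zero, hV.apply_zero] using
      is_const_of_deriv_eq_zero (fun r => (hasDerivAt_inner r).differentiableAt)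
        (fun r => (hasDerivAt_inner r).deriv) s 0
  have norm_sub_sq_eq_zero : ‖U s x - V s x‖ ^ 2 = 0 := by
    rw [@norm_sub_sq ℂ, inner_eq, hU.norm_map, hV.norm_map, inner_self_eq_norm_sq]
    ring
  simpa [sub_eq_zero] using norm_sub_sq_eq_zero

lemma expI_generator (hd : Dense ((generator U).domain : Set H)) : expI (generator U) = U 1 := by
  have h : ∃ V : ℝ → H →L[ℂ] H, IsUnitaryGroup V ∧ generator V = generator U := ⟨U, hU, rfl⟩
  rw [expI, dif_pos h]
  exact congrFun (hU.eq_of_generator_eq h.choose_spec.1 hd h.choose_spec.2.symm).symm 1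

end IsUnitaryGroup

/-- A dense `U`-invariant subspace of the domain of the generator of `U`. Such a subspace is a core
of the generator (Nelson's criterion, `IsInvariantCore.closure_eq`). -/
structure IsInvariantCore (U : ℝ → H →L[ℂ] H) (D : Submodule ℂ H) : Prop where
  dense : Dense (D : Set H)
  le_domain : D ≤ (generator U).domain
  map_mem : ∀ s, ∀ y ∈ D, U s y ∈ D

namespace IsInvariantCore

variable {D : Submodule ℂ H} (hU : IsUnitaryGroup U) (hD : IsInvariantCore U D)

include hU hD

lemma hasDerivAt_inner {x y z : H} (h : IsWeakValueOn (generator U) D x z) (hy : y ∈ D) (r : ℝ) :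
    HasDerivAt (fun r => ⟪y, U r x⟫_ℂ) ⟪y, I • U r z⟫_ℂ r := by
  obtain ⟨w, hyw⟩ := LinearPMap.mem_domain_iff.mp (hD.le_domain hy)
  have weak_value : ⟪U (-r) w, x⟫_ℂ = ⟪y, U r z⟫_ℂ := by
    rw [h _ (hD.map_mem (-r) y hy) _ (hU.mem_graph_map hyw (-r)), hU.inner_map_left, neg_neg]
  have hasDerivAt_left : HasDerivAt (fun r => U (-r) y) (-(I • U (-r) w)) r := by
    simpa [Function.comp_def] using
      HasDerivAt.scomp r (hU.hasDerivAt hyw (-r)) (hasDerivAt_neg r)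
  have inner_eq : (fun r => ⟪y, U r x⟫_ℂ) = fun r => ⟪U (-r) y, x⟫_ℂ := by
    funext r
    rw [hU.inner_map_left, neg_neg]
  rw [inner_eq]
  refine (hasDerivAt_left.inner ℂ (hasDerivAt_const r x)).congr_deriv ?_
  rw [inner_neg_left, inner_smul_left, inner_smul_right, weak_value, inner_zero_right,
    Complex.conj_I]
  ring

lemma apply_eq_add_integral [CompleteSpace H] {x z : H} (h : IsWeakValueOn (generator U) D x z)
    (s : ℝ) : U s x = x + ∫ r in (0 : ℝ)..s, I • U r z := by
  have continuous_orbit : Continuous fun r => I • U r z := (hU.continuous z).const_smul _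
  refine hD.dense.eq_of_inner_right ℂ fun y hy => ?_
  have inner_integral : ⟪y, ∫ r in (0 : ℝ)..s, I • U r z⟫_ℂ =
      ∫ r in (0 : ℝ)..s, ⟪y, I • U r z⟫_ℂ :=
    ((innerSL ℂ y).intervalIntegral_comp_comm (continuous_orbit.intervalIntegrable 0 s)).symm
  rw [inner_add_right, inner_integral, intervalIntegral.integral_eq_sub_of_hasDerivAt
    (fun r _ => hD.hasDerivAt_inner hU h hy r)
    ((continuous_const.inner continuous_orbit).intervalIntegrable 0 s), hU.apply_zero]
  ring

lemma mem_graph_iff_isWeakValueOn [CompleteSpace H] {x z : H} :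
    (x, z) ∈ (generator U).graph ↔ IsWeakValueOn (generator U) D x z := by
  refine ⟨fun hxz y _ w hyw => hU.inner_graph hxz hyw, fun h => ?_⟩
  have hasDerivAt_integral : HasDerivAt (fun s => x + ∫ r in (0 : ℝ)..s, I • U r z) (I • z) 0 := by
    simpa [hU.apply_zero] using
      (((hU.continuous z).const_smul I).integral_hasStrictDerivAt 0 0).hasDerivAt.const_add x
  rw [mem_generator_graph]
  simpa only [hD.apply_eq_add_integral hU h] using hasDerivAt_integral

lemma isClosed_generator [CompleteSpace H] : (generator U).IsClosed := by
  have graph_eq : ((generator U).graph : Set (H × H)) =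
      ⋂ (y : H) (_ : y ∈ D) (w : H) (_ : (y, w) ∈ (generator U).graph),
        {p : H × H | ⟪w, p.1⟫_ℂ = ⟪y, p.2⟫_ℂ} := by
    ext ⟨x, z⟩
    rw [SetLike.mem_coe, hD.mem_graph_iff_isWeakValueOn hU]
    simp only [IsWeakValueOn, SetLike.mem_coe, Set.mem_iInter, Set.mem_ofPred_eq]
  rw [LinearPMap.IsClosed, graph_eq]
  refine isClosed_iInter fun y => isClosed_iInter fun _ => isClosed_iInter fun w =>
    isClosed_iInter fun _ => isClosed_eq ?_ ?_ <;> fun_prop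

lemma closure_eq [CompleteSpace H] {B : H →ₗ.[ℂ] H} (hDB : D ≤ B.domain)
    (h : ∀ x : B.domain, IsWeakValueOn (generator U) D x (B x)) : B.closure = generator U := by
  have graph_le : B.graph ≤ (generator U).graph := by
    rintro ⟨x, z⟩ hxz
    obtain ⟨x, rfl, rfl⟩ := (LinearPMap.mem_graph_iff _).mp hxz
    exact (hD.mem_graph_iff_isWeakValueOn hU).mpr (h x)
  have isClosed := hD.isClosed_generator hU
  have isClosable : B.IsClosable :=
    isClosed.isClosable.leIsClosable (LinearPMap.le_of_le_graph graph_le)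
  apply LinearPMap.eq_of_eq_graph
  rw [← isClosable.graph_closure_eq_closure_graph]
  refine le_antisymm (Submodule.topologicalClosure_minimal _ graph_le isClosed) ?_
  rintro ⟨x, z⟩ hxz
  -- A vector `(p, q)` orthogonal to the graph of `B` has `A q = -p`, hence is orthogonal to the
  -- graph of the symmetric operator `A`.
  refine mem_topologicalClosure_of_forall_inner fun p q orthogonal => ?_
  have hqp : (q, -p) ∈ (generator U).graph := by
    refine (hD.mem_graph_iff_isWeakValueOn hU).mpr fun y hy w hyw => ?_
    have hyB : (y, B ⟨y, hDB hy⟩) ∈ B.graph := B.mem_graph ⟨y, hDB hy⟩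
    rw [← (generator U).mem_graph_snd_inj hyw (graph_le hyB) rfl] at hyB
    have orthogonal_conj := congrArg (starRingEnd ℂ) (orthogonal y w hyB)
    simp only [map_add, inner_conj_symm, map_zero] at orthogonal_conj
    rw [inner_neg_right]
    linear_combination orthogonal_conj
  have symm := hU.inner_graph hxz hqp
  rw [inner_neg_left] at symm
  linear_combination -symm

end IsInvariantCore

end UnitaryGroups

/-! ### Weak criteria for continuity and holomorphy -/

section WeakCriteria

lemma continuous_of_continuous_inner {𝕜 E X : Type*} [RCLike 𝕜] [NormedAddCommGroup E]
    [InnerProductSpace 𝕜 E] [TopologicalSpace X] {f : X → E}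
    (h : Continuous fun p : X × X => ⟪f p.1, f p.2⟫_𝕜) : Continuous f := by
  have continuous_inner : ∀ {g k : X → X}, Continuous g → Continuous k →
      Continuous fun y => ⟪f (g y), f (k y)⟫_𝕜 := fun hg hk => h.comp (hg.prodMk hk)
  refine continuous_iff_continuousAt.mpr fun x => tendsto_iff_norm_sub_tendsto_zero.mpr ?_
  have norm_sub_eq : (fun y => ‖f y - f x‖) = fun y => √(RCLike.re
      (⟪f y, f y⟫_𝕜 - ⟪f y, f x⟫_𝕜 - ⟪f x, f y⟫_𝕜 + ⟪f x, f x⟫_𝕜)) := by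
    funext y
    rw [← inner_sub_sub_self, ← norm_eq_sqrt_re_inner]
  have continuous_norm_sub : Continuous fun y => ‖f y - f x‖ := by
    rw [norm_sub_eq]
    exact Real.continuous_sqrt.comp (RCLike.continuous_re.comp
      ((((continuous_inner continuous_id continuous_id).sub
        (continuous_inner continuous_id continuous_const)).sub
        (continuous_inner continuous_const continuous_id)).add continuous_const))
  simpa using continuous_norm_sub.tendsto x

variable {E : Type*} [NormedAddCommGroup E] [InnerProductSpace ℂ E] [CompleteSpace E]

lemma inner_circleIntegral {f : ℂ → E} {c : ℂ} {R : ℝ} (hf : CircleIntegrable f c R) (w : E) :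
    ⟪w, ∮ z in C(c, R), f z⟫_ℂ = ∮ z in C(c, R), ⟪w, f z⟫_ℂ := by
  refine Eq.trans ((innerSL ℂ w).intervalIntegral_comp_comm hf.out).symm ?_
  exact intervalIntegral.integral_congr fun θ _ => inner_smul_right _ _ _

lemma circleIntegral_sub_inv_smul_of_differentiable_inner {f : ℂ → E} (hf : Continuous f)
    {D : Submodule ℂ E} (hD : Dense (D : Set E))
    (h : ∀ w ∈ D, Differentiable ℂ fun z => ⟪w, f z⟫_ℂ) {c z : ℂ} {R : ℝ}
    (hz : z ∈ Metric.ball c R) :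
    (2 * Real.pi * I : ℂ)⁻¹ • ∮ ζ in C(c, R), (ζ - z)⁻¹ • f ζ = f z := by
  have sub_ne_zero : ∀ ζ ∈ Metric.sphere c R, ζ - z ≠ 0 := fun ζ hζ =>
    sub_ne_zero.mpr (Metric.sphere_disjoint_ball.ne_of_mem hζ hz)
  have circleIntegrable : CircleIntegrable (fun ζ => (ζ - z)⁻¹ • f ζ) c R :=
    (((continuousOn_id.sub continuousOn_const).inv₀ sub_ne_zero).smul
      hf.continuousOn).circleIntegrable (Metric.pos_of_mem_ball hz).le
  refine hD.eq_of_inner_right ℂ fun w hw => ?_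
  rw [inner_smul_right, inner_circleIntegral circleIntegrable,
    ← ((h w hw).diffContOnCl (s := Metric.ball c R)).two_pi_i_inv_smul_circleIntegral_sub_inv_smul
      hz]
  simp only [inner_smul_right, smul_eq_mul]

lemma differentiable_of_differentiable_inner {f : ℂ → E} (hf : Continuous f) {S : Set E}
    (hS : Dense (Submodule.span ℂ S : Set E))
    (h : ∀ w ∈ S, Differentiable ℂ fun z => ⟪w, f z⟫_ℂ) : Differentiable ℂ f := by
  have differentiable_of_mem_span : ∀ w ∈ Submodule.span ℂ S,
      Differentiable ℂ fun z => ⟪w, f z⟫_ℂ := by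
    intro w hw
    induction hw using Submodule.span_induction with
    | mem w hw => exact h w hw
    | zero => simp
    | add w₁ w₂ _ _ ih₁ ih₂ => simpa only [inner_add_left] using ih₁.fun_add ih₂
    | smul a w _ ih => simpa only [inner_smul_left] using ih.const_mul _
  intro c
  have circleIntegrable : CircleIntegrable f c (1 : NNReal) :=
    hf.continuousOn.circleIntegrable zero_le_one
  have ball_mem_nhds : Metric.eball c ((1 : NNReal) : ENNReal) ∈ nhds c :=
    Metric.eball_mem_nhds c (by simp)
  refine ((hasFPowerSeriesOn_cauchy_integral circleIntegrable
    one_pos).differentiableOn.differentiableAt ball_mem_nhds).congr_of_eventuallyEq ?_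
  filter_upwards [ball_mem_nhds] with z hz
  rw [Metric.eball_coe] at hz
  exact (circleIntegral_sub_inv_smul_of_differentiable_inner hf hS differentiable_of_mem_span
    hz).symm

end WeakCriteria

/-! ### Exponential and creation vectors -/

section ExponentialVectors

lemma norm_linearCombination_eq_of_inner_eq {ι 𝕜 E F : Type*} [RCLike 𝕜]
    [SeminormedAddCommGroup E] [InnerProductSpace 𝕜 E] [SeminormedAddCommGroup F]
    [InnerProductSpace 𝕜 F] {x : ι → E} {y : ι → F} (h : ∀ i j, ⟪x i, x j⟫_𝕜 = ⟪y i, y j⟫_𝕜)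
    (c : ι →₀ 𝕜) :
    ‖Finsupp.linearCombination 𝕜 x c‖ = ‖Finsupp.linearCombination 𝕜 y c‖ := by
  simp only [@norm_eq_sqrt_re_inner 𝕜, Finsupp.linearCombination_apply, Finsupp.sum, sum_inner,
    inner_sum, inner_smul_left, inner_smul_right, h]

variable {K : Type} [NormedAddCommGroup K] [InnerProductSpace ℂ K]

variable (K) in
/-- The linear span of the exponential vectors, the common core of all field operators. -/
def expSpan : Submodule ℂ (Fock K) := Submodule.span ℂ (Set.range expVec)

lemma expVec_mem_expSpan (v : K) : expVec v ∈ expSpan K := Submodule.subset_span ⟨v, rfl⟩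

lemma dense_expSpan : Dense (expSpan K : Set (Fock K)) := by
  have h := denseRange_expVec (K := K)
  rwa [DenseRange, ← LinearMap.coe_range, Finsupp.range_linearCombination] at h

lemma fock_clm_ext {E : Type*} [NormedAddCommGroup E] [NormedSpace ℂ E] {f g : Fock K →L[ℂ] E}
    (h : ∀ v, f (expVec v) = g (expVec v)) : f = g := by
  refine ContinuousLinearMap.ext_on dense_expSpan ?_
  rintro _ ⟨v, rfl⟩
  exact h v

lemma fock_ext {x y : Fock K} (h : ∀ w : K, ⟪expVec w, x⟫_ℂ = ⟪expVec w, y⟫_ℂ) : x = y := by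
  have innerSL_eq : innerSL ℂ x = innerSL ℂ y := fock_clm_ext fun w => by
    simpa only [innerSL_apply_apply, inner_conj_symm] using congrArg (starRingEnd ℂ) (h w)
  exact ext_inner_right ℂ fun w => DFunLike.congr_fun innerSL_eq w

section Lift

variable {E : Type*} [NormedAddCommGroup E] [InnerProductSpace ℂ E] {y : K → E}

lemma norm_linearCombination_eq_norm_expVec (hy : ∀ u v, ⟪y u, y v⟫_ℂ = Complex.exp ⟪u, v⟫_ℂ)
    (c : K →₀ ℂ) : ‖Finsupp.linearCombination ℂ y c‖ =
      ‖Finsupp.linearCombination ℂ (expVec : K → Fock K) c‖ :=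
  norm_linearCombination_eq_of_inner_eq (fun u v => (hy u v).trans (inner_expVec u v).symm) c

variable [CompleteSpace E]

lemma extendOfNorm_expVec_apply (hy : ∀ u v, ⟪y u, y v⟫_ℂ = Complex.exp ⟪u, v⟫_ℂ) (c : K →₀ ℂ) :
    (Finsupp.linearCombination ℂ y).extendOfNorm
      (Finsupp.linearCombination ℂ (expVec : K → Fock K))
      (Finsupp.linearCombination ℂ expVec c) = Finsupp.linearCombination ℂ y c :=
  LinearMap.extendOfNorm_eq denseRange_expVec
    ⟨1, fun c => by rw [one_mul, norm_linearCombination_eq_norm_expVec hy]⟩ c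

/-- The universal property of the Fock space: vectors with the Gram kernel of the exponential
vectors span an isometric copy of the Fock space. -/
def fockLift (y : K → E) (hy : ∀ u v, ⟪y u, y v⟫_ℂ = Complex.exp ⟪u, v⟫_ℂ) : Fock K →ₗᵢ[ℂ] E where
  toLinearMap := ((Finsupp.linearCombination ℂ y).extendOfNorm
    (Finsupp.linearCombination ℂ (expVec : K → Fock K)) : Fock K →L[ℂ] E)
  norm_map' x := by
    refine denseRange_expVec.induction_on x (isClosed_eq (by fun_prop) (by fun_prop)) fun c => ?_
    rw [← norm_linearCombination_eq_norm_expVec hy, ← extendOfNorm_expVec_apply hy]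
    rfl

lemma fockLift_expVec (hy : ∀ u v, ⟪y u, y v⟫_ℂ = Complex.exp ⟪u, v⟫_ℂ) (v : K) :
    fockLift y hy (expVec v) = y v := by
  have apply_single := extendOfNorm_expVec_apply hy (Finsupp.single v 1)
  rwa [Finsupp.linearCombination_single, Finsupp.linearCombination_single, one_smul,
    one_smul] at apply_single

end Lift

lemma norm_weyl (u : K) (x : Fock K) : ‖weyl u x‖ = ‖x‖ :=
  (fockLift (weylVec u) fun v w =>
    (inner_weylVec u v w).trans (inner_expVec v w)).norm_map x

lemma weyl_zero : weyl (0 : K) = 1 := fock_clm_ext fun v => by simp [weyl_expVec]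

lemma weyl_mul_weyl (u v : K) : weyl u * weyl v =
    Complex.exp (-I * ((⟪u, v⟫_ℂ).im : ℂ)) • weyl (u + v) := by
  refine fock_clm_ext fun w => ?_
  simp only [mul_apply_eq_comp, weyl_expVec, map_smul, smul_smul, smul_apply, ← Complex.exp_add,
    ← add_assoc]
  congr 2
  rw [@norm_add_sq ℂ _ _ _ _ u v, inner_add_right, inner_add_left]
  push_cast
  simp only [RCLike.re_eq_complex_re]
  linear_combination Complex.re_add_im ⟪u, v⟫_ℂ

lemma weyl_mul_weyl_of_im_eq_zero {u v : K} (h : (⟪u, v⟫_ℂ).im = 0) :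
    weyl u * weyl v = weyl (u + v) := by
  simp [weyl_mul_weyl, h]

lemma commute_weyl {u v : K} (h : (⟪u, v⟫_ℂ).im = 0) : Commute (weyl u) (weyl v) := by
  have h_symm : (⟪v, u⟫_ℂ).im = 0 := by rw [← inner_conj_symm, Complex.conj_im, h, neg_zero]
  rw [Commute, SemiconjBy, weyl_mul_weyl_of_im_eq_zero h, weyl_mul_weyl_of_im_eq_zero h_symm,
    add_comm]

lemma adjoint_weyl (u : K) : (weyl u).adjoint = weyl (-u) := by
  have weyl_mul_weyl_neg : weyl u * weyl (-u) = 1 := by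
    rw [weyl_mul_weyl_of_im_eq_zero, add_neg_cancel, weyl_zero]
    rw [inner_neg_right, Complex.neg_im, neg_eq_zero]
    exact inner_self_im (𝕜 := ℂ) u
  have adjoint_mul_weyl : (weyl u).adjoint * weyl u = 1 :=
    (ContinuousLinearMap.norm_map_iff_adjoint_comp_self _).mp (norm_weyl u)
  exact left_inv_eq_right_inv adjoint_mul_weyl weyl_mul_weyl_neg

lemma continuous_expVec : Continuous (expVec : K → Fock K) := by
  refine continuous_of_continuous_inner (𝕜 := ℂ) ?_
  simp only [inner_expVec]
  fun_prop

lemma differentiable_expVec_line (v g : K) : Differentiable ℂ fun z : ℂ => expVec (v + z • g) := by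
  refine differentiable_of_differentiable_inner (continuous_expVec.comp (by fun_prop))
    dense_expSpan ?_
  rintro _ ⟨w, rfl⟩
  simp only [inner_expVec, inner_add_right, inner_smul_right]
  fun_prop

/-- The vector `a(g)* expVec v` produced by the creation operator of `g`. -/
def creationVec (g v : K) : Fock K := deriv (fun z : ℂ => expVec (v + z • g)) 0

lemma hasDerivAt_expVec_line (v g : K) :
    HasDerivAt (fun z : ℂ => expVec (v + z • g)) (creationVec g v) 0 :=
  (differentiable_expVec_line v g 0).hasDerivAt

lemma hasDerivAt_inner_expVec_line (x : Fock K) (v g : K) :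
    HasDerivAt (fun z : ℂ => ⟪x, expVec (v + z • g)⟫_ℂ) ⟪x, creationVec g v⟫_ℂ 0 :=
  (innerSL ℂ x).hasFDerivAt.comp_hasDerivAt 0 (hasDerivAt_expVec_line v g)

lemma hasDerivAt_cexp_add_mul (a b : ℂ) :
    HasDerivAt (fun z : ℂ => Complex.exp (a + z * b)) (b * Complex.exp a) 0 := by
  simpa [mul_comm] using ((hasDerivAt_mul_const b).const_add a).cexp (x := (0 : ℂ))

lemma inner_creationVec_right (w g v : K) :
    ⟪expVec w, creationVec g v⟫_ℂ = ⟪w, g⟫_ℂ * Complex.exp ⟪w, v⟫_ℂ := by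
  refine (hasDerivAt_inner_expVec_line (expVec w) v g).unique ?_
  simpa only [inner_expVec, inner_add_right, inner_smul_right] using
    hasDerivAt_cexp_add_mul ⟪w, v⟫_ℂ ⟪w, g⟫_ℂ

lemma inner_creationVec_left (w g v : K) :
    ⟪creationVec g v, expVec w⟫_ℂ = ⟪g, w⟫_ℂ * Complex.exp ⟪v, w⟫_ℂ := by
  rw [← inner_conj_symm, inner_creationVec_right, map_mul, ← Complex.exp_conj, inner_conj_symm,
    inner_conj_symm]

lemma inner_creationVec_creationVec (g v h w : K) :
    ⟪creationVec g v, creationVec h w⟫_ℂ =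
      (⟪g, h⟫_ℂ + ⟪g, w⟫_ℂ * ⟪v, h⟫_ℂ) * Complex.exp ⟪v, w⟫_ℂ := by
  refine (hasDerivAt_inner_expVec_line (creationVec g v) w h).unique ?_
  simp only [inner_creationVec_left, inner_add_right, inner_smul_right]
  refine (((hasDerivAt_mul_const ⟪g, h⟫_ℂ).const_add ⟪g, w⟫_ℂ).mul
    (hasDerivAt_cexp_add_mul ⟪v, w⟫_ℂ ⟪v, h⟫_ℂ)).congr_deriv ?_
  simp only [zero_mul, add_zero]
  ring

lemma continuous_creationVec : Continuous fun p : K × K => creationVec p.1 p.2 := by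
  refine continuous_of_continuous_inner (𝕜 := ℂ) ?_
  simp only [inner_creationVec_creationVec]
  fun_prop

lemma differentiable_creationVec_line (g v h : K) :
    Differentiable ℂ fun z : ℂ => creationVec g (v + z • h) := by
  have continuous_line : Continuous fun z : ℂ => creationVec g (v + z • h) :=
    continuous_creationVec.comp (f := fun z : ℂ => (g, v + z • h)) (by fun_prop)
  refine differentiable_of_differentiable_inner continuous_line dense_expSpan ?_
  rintro _ ⟨w, rfl⟩
  simp only [inner_creationVec_right, inner_add_right, inner_smul_right]
  fun_prop

lemma weyl_creationVec (u g v : K) : weyl u (creationVec g v) =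
    Complex.exp (-(‖u‖ ^ 2 : ℝ) / 2 - ⟪u, v⟫_ℂ) •
      (creationVec g (u + v) - ⟪u, g⟫_ℂ • expVec (u + v)) := by
  have hasDerivAt_weyl :=
    (weyl u).hasFDerivAt.comp_hasDerivAt 0 (hasDerivAt_expVec_line v g)
  refine hasDerivAt_weyl.unique ?_
  have weyl_line : (weyl u ∘ fun z : ℂ => expVec (v + z • g)) = fun z : ℂ =>
      Complex.exp (-(‖u‖ ^ 2 : ℝ) / 2 - ⟪u, v⟫_ℂ + z * -⟪u, g⟫_ℂ) • expVec (u + v + z • g) := by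
    funext z
    rw [Function.comp_apply, weyl_expVec, inner_add_right, inner_smul_right, ← add_assoc]
    ring_nf
  rw [weyl_line]
  refine ((hasDerivAt_cexp_add_mul _ _).smul (hasDerivAt_expVec_line (u + v) g)).congr_deriv ?_
  simp only [zero_mul, add_zero, zero_smul]
  module

end ExponentialVectors

/-! ### Field operators -/

section FieldOperators

variable {K : Type} [NormedAddCommGroup K] [InnerProductSpace ℂ K]

lemma hasDerivAt_imaginary_line {F : Type*} [NormedAddCommGroup F] [NormedSpace ℂ F] {f : ℂ → F}
    {f' : F} (hf : HasDerivAt f f' 0) : HasDerivAt (fun s : ℝ => f ((s : ℂ) * I)) (I • f') 0 := by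
  have hasDerivAt_ofReal_mul_I : HasDerivAt (fun s : ℝ => (s : ℂ) * I) I 0 := by
    simpa using (Complex.ofRealCLM.hasDerivAt (x := (0 : ℝ))).mul_const I
  exact hf.scomp_of_eq (0 : ℝ) hasDerivAt_ofReal_mul_I (by simp)

lemma hasDerivAt_cexp_quadratic (a b : ℂ) :
    HasDerivAt (fun z : ℂ => Complex.exp (z ^ 2 * a / 2 + z * b)) b 0 := by
  have hasDerivAt_exponent :=
    (((hasDerivAt_pow 2 (0 : ℂ)).mul_const a).div_const 2).add (hasDerivAt_mul_const (x := 0) b)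
  simpa using hasDerivAt_exponent.cexp

lemma inner_imaginary_smul_left (s : ℝ) (h v : K) :
    ⟪((s : ℂ) * I) • h, v⟫_ℂ = -((s : ℂ) * I * ⟪h, v⟫_ℂ) := by
  rw [inner_smul_left]
  simp

lemma weylFactor_imaginary_smul (s : ℝ) (h v : K) :
    Complex.exp (-(‖((s : ℂ) * I) • h‖ ^ 2 : ℝ) / 2 - ⟪((s : ℂ) * I) • h, v⟫_ℂ) =
      Complex.exp (((s : ℂ) * I) ^ 2 * (‖h‖ : ℂ) ^ 2 / 2 + (s : ℂ) * I * ⟪h, v⟫_ℂ) := by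
  have norm_sq : ‖((s : ℂ) * I) • h‖ ^ 2 = s ^ 2 * ‖h‖ ^ 2 := by
    rw [norm_smul, mul_pow]
    simp
  rw [norm_sq, inner_imaginary_smul_left]
  push_cast
  congr 1
  linear_combination (-(s : ℂ) ^ 2 * (‖h‖ : ℂ) ^ 2 / 2) * Complex.I_sq

lemma weyl_imaginary_expVec (s : ℝ) (h v : K) : weyl (((s : ℂ) * I) • h) (expVec v) =
    Complex.exp (((s : ℂ) * I) ^ 2 * (‖h‖ : ℂ) ^ 2 / 2 + (s : ℂ) * I * ⟪h, v⟫_ℂ) •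
      expVec (v + ((s : ℂ) * I) • h) := by
  rw [weyl_expVec, weylFactor_imaginary_smul, add_comm v]

lemma weyl_imaginary_creationVec (s : ℝ) (h g v : K) :
    weyl (((s : ℂ) * I) • h) (creationVec g v) =
      Complex.exp (((s : ℂ) * I) ^ 2 * (‖h‖ : ℂ) ^ 2 / 2 + (s : ℂ) * I * ⟪h, v⟫_ℂ) •
        (creationVec g (v + ((s : ℂ) * I) • h) +
          ((s : ℂ) * I * ⟪h, g⟫_ℂ) • expVec (v + ((s : ℂ) * I) • h)) := by
  rw [weyl_creationVec, weylFactor_imaginary_smul, inner_imaginary_smul_left, neg_smul,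
    sub_neg_eq_add, add_comm v]

lemma isUnitaryGroup_weyl (h : K) : IsUnitaryGroup fun s : ℝ => weyl (((s : ℂ) * I) • h) where
  zero := by simp [weyl_zero]
  add s t := by
    have inner_im_eq_zero : (⟪((s : ℂ) * I) • h, ((t : ℂ) * I) • h⟫_ℂ).im = 0 := by
      have inner_self_im_eq_zero : (⟪I • h, I • h⟫_ℂ).im = 0 := inner_self_im (𝕜 := ℂ) (I • h)
      rw [mul_smul, mul_smul, inner_smul_left, inner_smul_right, Complex.conj_ofReal,
        Complex.im_ofReal_mul, Complex.im_ofReal_mul, inner_self_im_eq_zero, mul_zero, mul_zero]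
    rw [weyl_mul_weyl_of_im_eq_zero inner_im_eq_zero, ← add_smul, ← add_mul, Complex.ofReal_add]
  norm_map s := norm_weyl _
  continuous := by
    refine continuous_apply_of_dense_span (fun s => norm_weyl _) dense_expSpan ?_
    rintro _ ⟨v, rfl⟩
    simp only [weyl_imaginary_expVec]
    have continuous_factor : Continuous fun s : ℝ =>
        Complex.exp (((s : ℂ) * I) ^ 2 * (‖h‖ : ℂ) ^ 2 / 2 + (s : ℂ) * I * ⟪h, v⟫_ℂ) := by fun_prop
    exact continuous_factor.smul (continuous_expVec.comp (by fun_prop))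

/-- The vector `(a(h) + a(h)*) expVec v`, as a function of `h`. -/
def fieldVec (v : K) : K →L[ℝ] Fock K where
  toFun h := ⟪h, v⟫_ℂ • expVec v + creationVec h v
  map_add' g h := fock_ext fun w => by
    simp only [inner_add_right, inner_smul_right, inner_creationVec_right, inner_add_left]
    ring
  map_smul' c h := fock_ext fun w => by
    simp only [RingHom.id_apply, ← Complex.coe_smul, inner_add_right, inner_smul_right,
      inner_creationVec_right, inner_smul_left, Complex.conj_ofReal]
    ring
  cont := by
    have continuous_creationVec_left : Continuous fun h : K => creationVec h v :=
      continuous_creationVec.comp (f := fun h : K => (h, v)) (by fun_prop)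
    have continuous_inner : Continuous fun h : K => ⟪h, v⟫_ℂ := by fun_prop
    exact (continuous_inner.smul continuous_const).add continuous_creationVec_left

lemma fieldVec_apply (v h : K) : fieldVec v h = ⟪h, v⟫_ℂ • expVec v + creationVec h v := rfl

lemma fieldVec_zero (h : K) : fieldVec 0 h = creationVec h 0 := by
  rw [fieldVec_apply, inner_zero_right, zero_smul, zero_add]

lemma expVec_mem_fieldOp_graph (h v : K) : (expVec v, fieldVec v h) ∈ (fieldOp h).graph := by
  rw [fieldOp, mem_generator_graph]
  simp only [weyl_imaginary_expVec]
  refine hasDerivAt_imaginary_line (((hasDerivAt_cexp_quadratic _ _).smul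
    (hasDerivAt_expVec_line v h)).congr_deriv ?_)
  simp [fieldVec_apply, add_comm]

lemma creationVec_mem_fieldOp_domain (g h v : K) : creationVec g v ∈ (fieldOp h).domain := by
  change DifferentiableAt ℝ (fun s : ℝ => weyl (((s : ℂ) * I) • h) (creationVec g v)) 0
  simp only [weyl_imaginary_creationVec]
  have differentiable_factor : Differentiable ℂ fun z : ℂ =>
      Complex.exp (z ^ 2 * (‖h‖ : ℂ) ^ 2 / 2 + z * ⟪h, v⟫_ℂ) := by fun_prop
  have differentiable_coeff : Differentiable ℂ fun z : ℂ => z * ⟪h, g⟫_ℂ := by fun_prop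
  have differentiable_orbit := differentiable_factor.smul
    ((differentiable_creationVec_line g v h).add
      (differentiable_coeff.smul (differentiable_expVec_line v h)))
  exact (hasDerivAt_imaginary_line (differentiable_orbit 0).hasDerivAt).differentiableAt

lemma isInvariantCore_expSpan (h : K) :
    IsInvariantCore (fun s : ℝ => weyl (((s : ℂ) * I) • h)) (expSpan K) where
  dense := dense_expSpan
  le_domain := by
    refine Submodule.span_le.mpr ?_
    rintro _ ⟨v, rfl⟩
    exact LinearPMap.mem_domain_of_mem_graph (expVec_mem_fieldOp_graph h v)
  map_mem s := by
    change expSpan K ≤ (expSpan K).comap (weyl (((s : ℂ) * I) • h) : Fock K →ₗ[ℂ] Fock K)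
    refine Submodule.span_le.mpr ?_
    rintro _ ⟨v, rfl⟩
    rw [SetLike.mem_coe, Submodule.mem_comap, ContinuousLinearMap.coe_coe, weyl_expVec]
    exact Submodule.smul_mem _ _ (expVec_mem_expSpan _)

lemma expI_fieldOp (h : K) : expI (fieldOp h) = weyl (I • h) := by
  have dense_domain := (isInvariantCore_expSpan h).dense.mono (isInvariantCore_expSpan h).le_domain
  rw [fieldOp, (isUnitaryGroup_weyl h).expI_generator dense_domain]
  simp

/-- The operator `B` is defined on the exponential vectors and is formally adjoint there to the
field operator of `h`. This relation is additive in `(B, h)`, and it determines the closure of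
`B` (`IsFieldOnExp.closure_eq`). -/
structure IsFieldOnExp (B : Fock K →ₗ.[ℂ] Fock K) (h : K) : Prop where
  mem_domain : ∀ v, expVec v ∈ B.domain
  inner_eq : ∀ v, ∀ x : B.domain, ⟪fieldVec v h, (x : Fock K)⟫_ℂ = ⟪expVec v, B x⟫_ℂ

namespace IsFieldOnExp

variable {B C : Fock K →ₗ.[ℂ] Fock K} {g h : K}

lemma closure_eq (hB : IsFieldOnExp B h) : B.closure = fieldOp h := by
  have range_expVec_subset : ∀ {A : Fock K →ₗ.[ℂ] Fock K}, (∀ v, expVec v ∈ A.domain) →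
      Set.range expVec ⊆ (A.domain : Set (Fock K)) := fun hA => Set.range_subset_iff.mpr hA
  refine (isInvariantCore_expSpan h).closure_eq (isUnitaryGroup_weyl h)
    (Submodule.span_le.mpr (range_expVec_subset hB.mem_domain)) fun x => ?_
  refine IsWeakValueOn.span ?_ (range_expVec_subset fun v =>
    (isInvariantCore_expSpan h).le_domain (expVec_mem_expSpan v))
  rintro _ ⟨v, rfl⟩ w hw
  rw [(fieldOp h).mem_graph_snd_inj hw (expVec_mem_fieldOp_graph h v) rfl]
  exact hB.inner_eq v x

lemma zero : IsFieldOnExp (0 : Fock K →ₗ.[ℂ] Fock K) 0 where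
  mem_domain v := Submodule.mem_top
  inner_eq v x := by
    rw [map_zero, inner_zero_left]
    exact (inner_zero_right _).symm

lemma add (hB : IsFieldOnExp B g) (hC : IsFieldOnExp C h) : IsFieldOnExp (B + C) (g + h) where
  mem_domain v := ⟨hB.mem_domain v, hC.mem_domain v⟩
  inner_eq v x := by
    rw [LinearPMap.add_apply, inner_add_right, ← hB.inner_eq, ← hC.inner_eq, map_add,
      inner_add_left]

lemma smul (hB : IsFieldOnExp B g) (c : ℝ) : IsFieldOnExp ((c : ℂ) • B) ((c : ℂ) • g) where
  mem_domain v := hB.mem_domain v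
  inner_eq v x := by
    rw [LinearPMap.smul_apply, inner_smul_right, ← hB.inner_eq, Complex.coe_smul, map_smul,
      ← Complex.coe_smul, inner_smul_left, Complex.conj_ofReal]

lemma sum {ι : Type*} {B : ι → Fock K →ₗ.[ℂ] Fock K} {g : ι → K} (s : Finset ι)
    (h : ∀ i ∈ s, IsFieldOnExp (B i) (g i)) : IsFieldOnExp (∑ i ∈ s, B i) (∑ i ∈ s, g i) := by
  classical
  induction s using Finset.induction_on with
  | empty => exact zero
  | insert i s hi ih =>
    rw [Finset.sum_insert hi, Finset.sum_insert hi]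
    exact (h i (Finset.mem_insert_self i s)).add
      (ih fun j hj => h j (Finset.mem_insert_of_mem hj))

end IsFieldOnExp

lemma isFieldOnExp_fieldOp (h : K) : IsFieldOnExp (fieldOp h) h where
  mem_domain v := (isInvariantCore_expSpan h).le_domain (expVec_mem_expSpan v)
  inner_eq v x := (isUnitaryGroup_weyl h).inner_graph ((fieldOp h).mem_graph x)
    (expVec_mem_fieldOp_graph h v)

lemma linComb_fieldOp {ι : Type} [Fintype ι] (u : ι → ℝ) (g : ι → K) :
    linComb u (fun a => fieldOp (g a)) = fieldOp (∑ a, (u a : ℂ) • g a) :=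
  (IsFieldOnExp.sum _ fun a _ => (isFieldOnExp_fieldOp (g a)).smul (u a)).closure_eq

lemma smul_fieldOp_le (c : ℝ) (h : K) : (c : ℂ) • fieldOp h ≤ fieldOp ((c : ℂ) • h) := by
  rw [← ((isFieldOnExp_fieldOp h).smul c).closure_eq]
  exact LinearPMap.le_closure _

lemma smul_fieldOp {c : ℝ} (hc : c ≠ 0) (h : K) : (c : ℂ) • fieldOp h = fieldOp ((c : ℂ) • h) := by
  have domain_le := (smul_fieldOp_le c⁻¹ ((c : ℂ) • h)).1
  rw [smul_smul, ← Complex.ofReal_mul, inv_mul_cancel₀ hc, Complex.ofReal_one, one_smul]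
    at domain_le
  exact LinearPMap.eq_of_le_of_domain_eq (smul_fieldOp_le c h)
    (le_antisymm (smul_fieldOp_le c h).1 domain_le)

lemma applyOrZero_fieldOp_expVec (h v : K) :
    applyOrZero (fieldOp h) (expVec v) = fieldVec v h := by
  have mem_domain := (isFieldOnExp_fieldOp h).mem_domain v
  rw [applyOrZero, dif_pos mem_domain]
  exact (fieldOp h).mem_graph_snd_inj ((fieldOp h).mem_graph ⟨_, mem_domain⟩)
    (expVec_mem_fieldOp_graph h v) rfl

lemma inner_applyOrZero_fieldOp {h : K} (v : K) {x : Fock K} (hx : x ∈ (fieldOp h).domain) :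
    ⟪expVec v, applyOrZero (fieldOp h) x⟫_ℂ = ⟪fieldVec v h, x⟫_ℂ := by
  rw [applyOrZero, dif_pos hx, (isFieldOnExp_fieldOp h).inner_eq v ⟨x, hx⟩]

lemma strongIntegral_fieldOp [CompleteSpace K] {T : ℝ} {φ : ℝ → ℝ} {h : ℝ → K}
    (hφh : IntegrableOn (fun t => φ t • h t) (Set.Icc 0 T)) {A : ℝ → Fock K →ₗ.[ℂ] Fock K}
    (hA : ∀ t ∈ Set.Icc 0 T, A t = fieldOp (h t)) :
    strongIntegral T φ A = fieldOp (∫ t in Set.Icc 0 T, φ t • h t) := by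
  refine IsFieldOnExp.closure_eq ⟨fun v => ⟨fun t ht => ?_, ?_⟩, ?_⟩
  · rw [hA t ht]
    exact (isFieldOnExp_fieldOp _).mem_domain v
  · refine IntegrableOn.congr_fun ((fieldVec v).integrable_comp hφh) (fun t ht => ?_)
      measurableSet_Icc
    rw [hA t ht, applyOrZero_fieldOp_expVec, map_smul]
  · rintro v ⟨x, mem_domain, integrableOn⟩
    change _ = ⟪expVec v, ∫ t in Set.Icc 0 T, φ t • applyOrZero (A t) x⟫_ℂ
    have inner_fieldVec_integral : ⟪fieldVec v (∫ t in Set.Icc 0 T, φ t • h t), x⟫_ℂ =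
        ∫ t in Set.Icc 0 T, ⟪fieldVec v (φ t • h t), x⟫_ℂ := by
      rw [← ContinuousLinearMap.integral_comp_comm _ hφh, ← inner_conj_symm,
        ← integral_inner ((fieldVec v).integrable_comp hφh), ← integral_conj]
      simp only [inner_conj_symm]
    rw [inner_fieldVec_integral, ← integral_inner integrableOn]
    refine setIntegral_congr_fun measurableSet_Icc fun t ht => ?_
    have mem_fieldOp_domain : x ∈ (fieldOp (h t)).domain := hA t ht ▸ mem_domain t ht
    simp only [hA t ht, map_smul, inner_smul_left_eq_smul, inner_smul_right_eq_smul,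
      inner_applyOrZero_fieldOp v mem_fieldOp_domain]

end FieldOperators

/-! ### Amplification and purification -/

section Amplification

variable {ι H : Type} [NormedAddCommGroup H] [InnerProductSpace ℂ H]

variable (ι H) in
/-- The Hilbert sum of copies of `H`, which plays the role of `H ⊗ ℓ²(ι)`. -/
abbrev Amplified : Type := lp (fun _ : ι => H) 2

/-- The amplification `X ⊗ 1` of a bounded operator to the Hilbert sum. -/
def amplify (X : H →L[ℂ] H) : Amplified ι H →L[ℂ] Amplified ι H :=
  lp.mapCLM 2 (fun _ => X) (norm_nonneg X) fun _ => le_rfl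

lemma amplify_apply (X : H →L[ℂ] H) (ξ : Amplified ι H) (i : ι) : amplify X ξ i = X (ξ i) := rfl

lemma amplify_one : amplify (1 : H →L[ℂ] H) = (1 : Amplified ι H →L[ℂ] Amplified ι H) := rfl

lemma amplify_mul (X Y : H →L[ℂ] H) :
    (amplify (X * Y) : Amplified ι H →L[ℂ] Amplified ι H) = amplify X * amplify Y := rfl

lemma amplify_smul (c : ℂ) (X : H →L[ℂ] H) :
    (amplify (c • X) : Amplified ι H →L[ℂ] Amplified ι H) = c • amplify X := rfl

lemma amplify_single [DecidableEq ι] (X : H →L[ℂ] H) (j : ι) (x : H) :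
    amplify X (lp.single 2 j x : Amplified ι H) = lp.single 2 j (X x) := by
  ext i
  rw [amplify_apply, lp.single_apply, lp.single_apply]
  exact Pi.apply_single (fun _ => X) (fun _ => map_zero X) j x i

/-- The map `x ↦ x ⊗ conj a` into the Hilbert sum. -/
def tensorConj (a : lp (fun _ : ι => ℂ) 2) : H →L[ℂ] Amplified ι H :=
  LinearMap.mkContinuous
    { toFun := fun x => lp.mapCLM 2 (fun _ => ContinuousLinearMap.toSpanSingleton ℂ x)
        (norm_nonneg x) (fun _ => (ContinuousLinearMap.norm_toSpanSingleton x).le) (star a)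
      map_add' := fun x y => by
        ext i
        simp
      map_smul' := fun c x => by
        ext i
        exact smul_comm (star (a i)) c x }
    ‖a‖ fun x => by
      rw [mul_comm, ← norm_star a]
      exact ContinuousLinearMap.le_of_opNorm_le _ (lp.norm_mapCLM_le 2
        (fun _ : ι => ContinuousLinearMap.toSpanSingleton ℂ x) (norm_nonneg x)
        fun _ => (ContinuousLinearMap.norm_toSpanSingleton x).le) (star a)

lemma tensorConj_apply (a : lp (fun _ : ι => ℂ) 2) (x : H) (i : ι) :
    tensorConj a x i = starRingEnd ℂ (a i) • x := rfl

lemma amplify_tensorConj (X : H →L[ℂ] H) (a : lp (fun _ : ι => ℂ) 2) (x : H) :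
    amplify X (tensorConj a x) = tensorConj a (X x) := by
  ext i
  rw [amplify_apply, tensorConj_apply, tensorConj_apply, map_smul]

lemma hasSum_norm_inner_sq {κ : Type*} (b : HilbertBasis κ ℂ H) (x : H) :
    HasSum (fun i => ‖⟪b i, x⟫_ℂ‖ ^ 2) (‖x‖ ^ 2) := by
  simpa [HilbertBasis.repr_apply_apply] using lp.hasSum_norm (by simp) (b.repr x)

lemma summable_norm_inner_sq {κ : Type*} (b : HilbertBasis κ ℂ H) (ξ : Amplified ι H) :
    Summable fun p : ι × κ => ‖⟪b p.2, ξ p.1⟫_ℂ‖ ^ 2 := by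
  refine (summable_prod_of_nonneg fun p => by positivity).mpr
    ⟨fun j => (hasSum_norm_inner_sq b (ξ j)).summable, ?_⟩
  simpa [(hasSum_norm_inner_sq b (ξ _)).tsum_eq] using (lp.memℓp ξ).summable (by simp)

lemma hasSum_inner_mul_inner_amplified {κ : Type*} (b : HilbertBasis κ ℂ H)
    (ξ ζ : Amplified ι H) :
    HasSum (fun p : ι × κ => ⟪ξ p.1, b p.2⟫_ℂ * ⟪b p.2, ζ p.1⟫_ℂ) ⟪ξ, ζ⟫_ℂ := by
  have summable : Summable fun p : ι × κ => ⟪ξ p.1, b p.2⟫_ℂ * ⟪b p.2, ζ p.1⟫_ℂ := by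
    refine Summable.of_norm_bounded
      ((summable_norm_inner_sq b ξ).add (summable_norm_inner_sq b ζ)) fun p => ?_
    rw [norm_mul, norm_inner_symm]
    have two_mul_le := two_mul_le_add_sq ‖⟪b p.2, ξ p.1⟫_ℂ‖ ‖⟪b p.2, ζ p.1⟫_ℂ‖
    have mul_nonneg : 0 ≤ ‖⟪b p.2, ξ p.1⟫_ℂ‖ * ‖⟪b p.2, ζ p.1⟫_ℂ‖ := by positivity
    linarith
  have hasSum_fiberwise :=
    summable.hasSum.prod_fiberwise fun j => b.hasSum_inner_mul_inner (ξ j) (ζ j)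
  rw [(lp.hasSum_inner (𝕜 := ℂ) ξ ζ).unique hasSum_fiberwise]
  exact summable.hasSum

variable [CompleteSpace H]

lemma adjoint_amplify (X : H →L[ℂ] H) :
    (amplify X : Amplified ι H →L[ℂ] Amplified ι H).adjoint = amplify X.adjoint := by
  refine ((ContinuousLinearMap.eq_adjoint_iff _ _).mpr fun ξ ζ => ?_).symm
  simp only [lp.inner_eq_tsum, amplify_apply, ContinuousLinearMap.adjoint_inner_left]

/-- The partial contraction of a vector of the Hilbert sum with `y ∈ H`, where `ℓ²(ι)` is identified
with the conjugate space of `H` by a Hilbert basis. -/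
def contract (b : HilbertBasis ι ℂ H) (y : H) : Amplified ι H →L[ℂ] H :=
  (tensorConj (b.repr y)).adjoint

lemma contract_amplify (b : HilbertBasis ι ℂ H) (y : H) (X : H →L[ℂ] H) (ξ : Amplified ι H) :
    contract b y (amplify X ξ) = X (contract b y ξ) := by
  refine ext_inner_left ℂ fun x => ?_
  rw [contract, ContinuousLinearMap.adjoint_inner_right, ← ContinuousLinearMap.adjoint_inner_left,
    adjoint_amplify, amplify_tensorConj, ← ContinuousLinearMap.adjoint_inner_left X,
    ContinuousLinearMap.adjoint_inner_right]

lemma hasSum_inner_contract (b : HilbertBasis ι ℂ H) (x y : H) (ξ : Amplified ι H) :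
    HasSum (fun i => ⟪b i, y⟫_ℂ * ⟪x, ξ i⟫_ℂ) ⟪x, contract b y ξ⟫_ℂ := by
  rw [contract, ContinuousLinearMap.adjoint_inner_right]
  simpa only [tensorConj_apply, inner_smul_left, Complex.conj_conj, b.repr_apply_apply] using
    lp.hasSum_inner (𝕜 := ℂ) (tensorConj (b.repr y) x) ξ

/-- The vector `ψ = ∑ i, Q b i ⊗ e i` is a purification of the density operator `ρ = Q²`, where
`Q` is self-adjoint. -/
structure IsPurification (ρ Q : H →L[ℂ] H) (b : HilbertBasis ι ℂ H) (ψ : Amplified ι H) : Prop where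
  mul_self : Q * Q = ρ
  isSelfAdjoint : IsSelfAdjoint Q
  apply_eq : ∀ i, ψ i = Q (b i)

lemma IsDensityOperator.exists_purification {ρ : H →L[ℂ] H} (hρ : IsDensityOperator ρ) :
    ∃ (ι : Type) (b : HilbertBasis ι ℂ H) (Q : H →L[ℂ] H) (ψ : Amplified ι H),
      IsPurification ρ Q b ψ := by
  obtain ⟨ι, b, -⟩ := exists_hilbertBasis ℂ H
  have nonneg : 0 ≤ ρ := (ContinuousLinearMap.nonneg_iff_isPositive ρ).mpr hρ.isPositive
  have isSelfAdjoint : IsSelfAdjoint (CFC.sqrt ρ) := (CFC.sqrt_nonneg ρ).isSelfAdjoint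
  have mul_self : CFC.sqrt ρ * CFC.sqrt ρ = ρ := CFC.sqrt_mul_sqrt_self ρ nonneg
  have inner_map_self : ∀ x, ⟪x, ρ x⟫_ℂ = ((‖CFC.sqrt ρ x‖ ^ 2 : ℝ) : ℂ) := fun x => by
    rw [← mul_self, mul_apply_eq_comp, mul_self, ← ContinuousLinearMap.adjoint_inner_left,
      isSelfAdjoint.adjoint_eq, inner_self_eq_norm_sq_to_K]
    norm_cast
  have memℓp : Memℓp (fun i => CFC.sqrt ρ (b i)) 2 := by
    obtain ⟨_, hasSum⟩ := hρ.trace_eq_one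
    refine memℓp_gen ((Complex.hasSum_re (hasSum ι b)).summable.congr fun i => ?_)
    change (⟪b i, ρ (b i)⟫_ℂ).re = _
    rw [inner_map_self, Complex.ofReal_re]
    simp
  exact ⟨ι, b, CFC.sqrt ρ, ⟨_, memℓp⟩, mul_self, isSelfAdjoint, fun i => rfl⟩

namespace IsPurification

variable {ρ Q : H →L[ℂ] H} {b : HilbertBasis ι ℂ H} {ψ : Amplified ι H}
  (hψ : IsPurification ρ Q b ψ)

include hψ

lemma inner_map_left (x y : H) : ⟪Q x, y⟫_ℂ = ⟪x, Q y⟫_ℂ := by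
  rw [← ContinuousLinearMap.adjoint_inner_left, hψ.isSelfAdjoint.adjoint_eq]

lemma contract_eq (y : H) : contract b y ψ = Q y := by
  refine ext_inner_left ℂ fun x => (hasSum_inner_contract b x y ψ).unique ?_
  simpa only [hψ.apply_eq, hψ.inner_map_left, mul_comm] using b.hasSum_inner_mul_inner (Q x) y

lemma contract_map_eq (y : H) : contract b (Q y) ψ = ρ y := by
  rw [hψ.contract_eq, ← hψ.mul_self, mul_apply_eq_comp]

lemma hasSum_inner_contract_map {κ : Type*} (b' : HilbertBasis κ ℂ H) (ζ : Amplified ι H) :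
    HasSum (fun i => ⟪b' i, contract b (Q (b' i)) ζ⟫_ℂ) ⟪ψ, ζ⟫_ℂ := by
  have hasSum_swap := (Equiv.prodComm κ ι).hasSum_iff.mpr (hasSum_inner_mul_inner_amplified b' ψ ζ)
  refine hasSum_swap.prod_fiberwise fun i => ?_
  simpa only [Function.comp_apply, Equiv.prodComm_apply, Prod.fst_swap, Prod.snd_swap,
    hψ.apply_eq, hψ.inner_map_left] using hasSum_inner_contract b (b' i) (Q (b' i)) ζ

lemma hasExpectation {A : H →ₗ.[ℂ] H} {ζ : Amplified ι H}
    (h : ∀ y, (ρ y, contract b (Q y) ζ) ∈ A.graph) : HasExpectation ρ A ⟪ψ, ζ⟫_ℂ := by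
  refine ⟨fun y => LinearPMap.mem_domain_of_mem_graph (h y), fun κ b' => ?_⟩
  convert hψ.hasSum_inner_contract_map b' ζ using 3 with i
  exact A.mem_graph_snd_inj (A.mem_graph _) (h (b' i)) rfl

lemma hasExpectation_ofBounded (X : H →L[ℂ] H) :
    HasExpectation ρ (ofBounded X) ⟪ψ, amplify X ψ⟫_ℂ := by
  refine hψ.hasExpectation fun y => ?_
  rw [contract_amplify, hψ.contract_map_eq]
  exact (ofBounded X).mem_graph ⟨ρ y, Submodule.mem_top⟩

lemma inner_amplify_eq {X : H →L[ℂ] H} {c : ℂ} (h : HasExpectation ρ (ofBounded X) c) :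
    ⟪ψ, amplify X ψ⟫_ℂ = c :=
  ((hψ.hasExpectation_ofBounded X).choose_spec ι b).unique (h.choose_spec ι b)

end IsPurification

end Amplification

/-! ### Vector states on bicommutants -/

section Bicommutant

variable {ι H : Type} [NormedAddCommGroup H] [InnerProductSpace ℂ H] {S T : Set (H →L[ℂ] H)}

/-- Passing to the matrix entries of `P`, which lie in the commutant of `S`. -/
lemma commute_amplify_of_mem_bicommutant {P : Amplified ι H →L[ℂ] Amplified ι H}
    (hP : ∀ X ∈ S, Commute P (amplify X)) {A : H →L[ℂ] H}
    (hA : A ∈ Set.centralizer (Set.centralizer S)) : Commute P (amplify A) := by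
  classical
  let entry (i j : ι) : H →L[ℂ] H := lp.evalCLM ℂ (fun _ : ι => H) 2 i ∘L P ∘L
    lp.singleContinuousLinearMap ℂ (fun _ : ι => H) 2 j
  have commute_iff : ∀ X, Commute P (amplify X) ↔ ∀ i j, X * entry i j = entry i j * X := by
    intro X
    refine ⟨fun h i j => ?_, fun h => ?_⟩
    · ext x
      change amplify X (P (lp.single 2 j x)) i = P (lp.single 2 j (X x)) i
      rw [← amplify_single, ← mul_apply_eq_comp, ← h.eq, mul_apply_eq_comp]
    · refine lp.ext_continuousLinearMap (by simp) fun j => ?_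
      ext x i
      change P (amplify X (lp.single 2 j x)) i = X (P (lp.single 2 j x) i)
      rw [amplify_single]
      exact congrArg (fun Y : H →L[ℂ] H => Y x) (h i j).symm
  exact (commute_iff A).mpr fun i j => (hA _ fun X hX => (commute_iff X).mp (hP X hX) i j).symm

variable [CompleteSpace H]

/-- Sets of operators which contain the identity and are closed under adjoints and, up to scalar
factors, under products. This holds for Weyl operators, the scalars being the phases of the
canonical commutation relations. -/
structure IsProjectiveStarMonoid (S : Set (H →L[ℂ] H)) : Prop where
  one_mem : 1 ∈ S
  mul_mem : ∀ X ∈ S, ∀ Y ∈ S, ∃ c : ℂ, ∃ Z ∈ S, X * Y = c • Z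
  adjoint_mem : ∀ X ∈ S, X.adjoint ∈ S

/-- The closed subspace spanned by the vectors `(X ⊗ 1) ψ` for `X ∈ S`. -/
def cyclicSubspace (S : Set (H →L[ℂ] H)) (ψ : Amplified ι H) : Submodule ℂ (Amplified ι H) :=
  (Submodule.span ℂ ((fun X => amplify X ψ) '' S)).topologicalClosure

instance (ψ : Amplified ι H) : CompleteSpace (cyclicSubspace S ψ) :=
  (Submodule.isClosed_topologicalClosure _).completeSpace_coe

namespace IsProjectiveStarMonoid

variable (hS : IsProjectiveStarMonoid S)

include hS

lemma mem_cyclicSubspace (ψ : Amplified ι H) : ψ ∈ cyclicSubspace S ψ :=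
  Submodule.le_topologicalClosure _ (Submodule.subset_span ⟨1, hS.one_mem, rfl⟩)

lemma amplify_map_mem_cyclicSubspace (ψ : Amplified ι H) {X : H →L[ℂ] H} (hX : X ∈ S) :
    ∀ ξ ∈ cyclicSubspace S ψ, amplify X ξ ∈ cyclicSubspace S ψ := by
  have span_le_comap : Submodule.span ℂ ((fun X => amplify X ψ) '' S) ≤
      (Submodule.span ℂ ((fun X => amplify X ψ) '' S)).comap
        (amplify X).toLinearMap := by
    refine Submodule.span_le.mpr ?_
    rintro _ ⟨Y, hY, rfl⟩
    obtain ⟨c, Z, hZ, mul_eq⟩ := hS.mul_mem X hX Y hY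
    rw [SetLike.mem_coe, Submodule.mem_comap, ContinuousLinearMap.coe_coe, ← mul_apply_eq_comp,
      ← amplify_mul, mul_eq, amplify_smul]
    exact Submodule.smul_mem _ _ (Submodule.subset_span ⟨Z, hZ, rfl⟩)
  have mapsTo : Set.MapsTo (amplify X)
      (Submodule.span ℂ ((fun X => amplify X ψ) '' S) : Set (Amplified ι H))
      (Submodule.span ℂ ((fun X => amplify X ψ) '' S)) := span_le_comap
  exact mapsTo.closure (amplify X).continuous

lemma commute_starProjection_cyclicSubspace (ψ : Amplified ι H) {X : H →L[ℂ] H} (hX : X ∈ S) :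
    Commute (cyclicSubspace S ψ).starProjection (amplify X) := by
  rw [ContinuousLinearMap.IsIdempotentElem.commute_iff
    (Submodule.isIdempotentElem_starProjection _), Submodule.range_starProjection,
    Submodule.ker_starProjection, ← ContinuousLinearMap.mem_invtSubmodule_adjoint_iff,
    adjoint_amplify]
  exact ⟨hS.amplify_map_mem_cyclicSubspace ψ hX,
    hS.amplify_map_mem_cyclicSubspace ψ (hS.adjoint_mem X hX)⟩

end IsProjectiveStarMonoid

/-- The density part of von Neumann's bicommutant theorem. -/
lemma IsProjectiveStarMonoid.amplify_mem_cyclicSubspace (hS : IsProjectiveStarMonoid S)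
    {A : H →L[ℂ] H} (hA : A ∈ Set.centralizer (Set.centralizer S)) (ψ : Amplified ι H) :
    amplify A ψ ∈ cyclicSubspace S ψ := by
  have commute := commute_amplify_of_mem_bicommutant
    (fun X hX => hS.commute_starProjection_cyclicSubspace ψ hX) hA
  rw [← Submodule.starProjection_eq_self_iff, ← mul_apply_eq_comp, commute.eq, mul_apply_eq_comp,
    Submodule.starProjection_eq_self_iff.mpr (hS.mem_cyclicSubspace ψ)]

lemma IsProjectiveStarMonoid.map_amplify_eq_of_mem_bicommutant (hS : IsProjectiveStarMonoid S)
    {E : Type*} [NormedAddCommGroup E] [NormedSpace ℂ E] {f g : Amplified ι H →L[ℂ] E}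
    {ψ : Amplified ι H} (h : ∀ X ∈ S, f (amplify X ψ) = g (amplify X ψ)) {A : H →L[ℂ] H}
    (hA : A ∈ Set.centralizer (Set.centralizer S)) : f (amplify A ψ) = g (amplify A ψ) := by
  refine ContinuousLinearMap.eqOn_closure_span ?_ (hS.amplify_mem_cyclicSubspace hA ψ)
  rintro _ ⟨X, hX, rfl⟩
  exact h X hX

lemma inner_amplify_mul (ψ : Amplified ι H) (X Y : H →L[ℂ] H) :
    ⟪ψ, amplify (X * Y) ψ⟫_ℂ = ⟪amplify X.adjoint ψ, amplify Y ψ⟫_ℂ := by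
  rw [← adjoint_amplify, ContinuousLinearMap.adjoint_inner_left, amplify_mul, mul_apply_eq_comp]

/-- One bicommutant is reached at a time: `B ψ` is approximated from `T`, then `A* ψ` from `S`. -/
lemma inner_amplify_mul_of_mem_bicommutant (hS : IsProjectiveStarMonoid S)
    (hT : IsProjectiveStarMonoid T) {ψ : Amplified ι H}
    (hST : ∀ X ∈ S, ∀ Y ∈ T,
      ⟪ψ, amplify (X * Y) ψ⟫_ℂ = ⟪ψ, amplify X ψ⟫_ℂ * ⟪ψ, amplify Y ψ⟫_ℂ)
    {A B : H →L[ℂ] H} (hA : A ∈ Set.centralizer (Set.centralizer S))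
    (hB : B ∈ Set.centralizer (Set.centralizer T)) :
    ⟪ψ, amplify (A * B) ψ⟫_ℂ = ⟪ψ, amplify A ψ⟫_ℂ * ⟪ψ, amplify B ψ⟫_ℂ := by
  have inner_left : ∀ X ∈ S, ⟪amplify X ψ, amplify B ψ⟫_ℂ =
      ⟪amplify X ψ, ψ⟫_ℂ * ⟪ψ, amplify B ψ⟫_ℂ := by
    intro X hX
    refine hT.map_amplify_eq_of_mem_bicommutant (f := innerSL ℂ (amplify X ψ))
      (g := ⟪amplify X ψ, ψ⟫_ℂ • innerSL ℂ ψ) (fun Y hY => ?_) hB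
    have factorization := hST _ (hS.adjoint_mem X hX) Y hY
    rw [inner_amplify_mul, ContinuousLinearMap.adjoint_adjoint, ← adjoint_amplify,
      ContinuousLinearMap.adjoint_inner_right] at factorization
    simpa using factorization
  have hA_star : A.adjoint ∈ Set.centralizer (Set.centralizer S) :=
    Set.star_mem_centralizer' (fun _ => Set.star_mem_centralizer' hS.adjoint_mem) hA
  have inner_right : ⟪amplify B ψ, amplify A.adjoint ψ⟫_ℂ =
      ⟪amplify B ψ, ψ⟫_ℂ * ⟪ψ, amplify A.adjoint ψ⟫_ℂ := by
    refine hS.map_amplify_eq_of_mem_bicommutant (f := innerSL ℂ (amplify B ψ))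
      (g := ⟪amplify B ψ, ψ⟫_ℂ • innerSL ℂ ψ) (fun X hX => ?_) hA_star
    simpa [mul_comm] using congrArg (starRingEnd ℂ) (inner_left X hX)
  rw [inner_amplify_mul, ← inner_conj_symm, inner_right, ← adjoint_amplify, map_mul,
    inner_conj_symm, inner_conj_symm, ContinuousLinearMap.adjoint_inner_left, mul_comm]

end Bicommutant

/-! ### Vacuum states -/

section VacuumStates

variable {K : Type} [NormedAddCommGroup K] [InnerProductSpace ℂ K] {L M N : Submodule ℂ K}

/-- The von Neumann algebra generated by the Weyl operators of the vectors in `M`. -/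
def weylAlgebra (M : Submodule ℂ K) : Subalgebra ℂ (Fock K →L[ℂ] Fock K) :=
  Subalgebra.centralizer ℂ (Set.centralizer (weyl '' (M : Set K)))

lemma weylAlgebra_mono (h : M ≤ N) : weylAlgebra M ≤ weylAlgebra N :=
  Set.centralizer_subset (Set.centralizer_subset (Set.image_mono h))

lemma commute_of_mem_weylAlgebra (h : M ⟂ N) {A B : Fock K →L[ℂ] Fock K} (hA : A ∈ weylAlgebra M)
    (hB : B ∈ weylAlgebra N) : Commute A B := by
  have weyl_subset : weyl '' (N : Set K) ⊆ Set.centralizer (weyl '' (M : Set K)) := by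
    rintro _ ⟨v, hv, rfl⟩ _ ⟨u, hu, rfl⟩
    exact commute_weyl (by rw [h.inner_eq hu hv, Complex.zero_im])
  exact hB A (Set.centralizer_subset weyl_subset hA)

lemma isProjectiveStarMonoid_weyl (M : Submodule ℂ K) :
    IsProjectiveStarMonoid (weyl '' (M : Set K)) where
  one_mem := ⟨0, M.zero_mem, weyl_zero⟩
  mul_mem := by
    rintro _ ⟨u, hu, rfl⟩ _ ⟨v, hv, rfl⟩
    exact ⟨_, _, ⟨u + v, M.add_mem hu hv, rfl⟩, weyl_mul_weyl u v⟩
  adjoint_mem := by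
    rintro _ ⟨u, hu, rfl⟩
    exact ⟨-u, M.neg_mem hu, (adjoint_weyl u).symm⟩

lemma expI_linComb_fieldOp {κ : Type} [Fintype κ] (η : κ → K) (u : κ → ℝ) :
    expI (linComb u fun a => fieldOp (η a)) = weyl (I • ∑ a, (u a : ℂ) • η a) := by
  rw [linComb_fieldOp, expI_fieldOp]

lemma generatedAlgebra_fieldOp_subset {κ : Type} [Fintype κ] {η : κ → K} (hη : ∀ a, η a ∈ M) :
    generatedAlgebra (fun a => fieldOp (η a)) ⊆ weylAlgebra M := by
  refine Set.centralizer_subset (Set.centralizer_subset ?_)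
  rintro _ ⟨u, rfl⟩
  exact ⟨_, M.smul_mem _ (M.sum_mem fun a _ => M.smul_mem _ (hη a)),
    (expI_linComb_fieldOp η u).symm⟩

/-- The state `ρ` restricts to the vacuum state on the Weyl operators of the vectors in `L`. -/
def IsVacuumOn (L : Submodule ℂ K) (ρ : Fock K →L[ℂ] Fock K) : Prop :=
  ∀ u ∈ L, HasExpectation ρ (ofBounded (weyl u)) (Complex.exp (-(‖u‖ ^ 2 : ℝ) / 2))

/-- The vector state of `ψ` restricts to the vacuum state on the Weyl operators of the vectors
in `L`. -/
def IsVacuumVector {ι : Type} (L : Submodule ℂ K) (ψ : Amplified ι (Fock K)) : Prop :=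
  ∀ u ∈ L, ⟪ψ, amplify (weyl u) ψ⟫_ℂ = Complex.exp (-(‖u‖ ^ 2 : ℝ) / 2)

section VacuumVectors

variable {ι : Type} {ψ : Amplified ι (Fock K)}

lemma IsVacuumVector.inner_amplify_mul_of_mem_weylAlgebra (hψ : IsVacuumVector L ψ) (hM : M ≤ L)
    (hN : N ≤ L) (hMN : M ⟂ N) {A B : Fock K →L[ℂ] Fock K} (hA : A ∈ weylAlgebra M)
    (hB : B ∈ weylAlgebra N) :
    ⟪ψ, amplify (A * B) ψ⟫_ℂ = ⟪ψ, amplify A ψ⟫_ℂ * ⟪ψ, amplify B ψ⟫_ℂ := by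
  refine inner_amplify_mul_of_mem_bicommutant (isProjectiveStarMonoid_weyl M)
    (isProjectiveStarMonoid_weyl N) ?_ hA hB
  rintro _ ⟨u, hu, rfl⟩ _ ⟨v, hv, rfl⟩
  have inner_eq_zero : ⟪u, v⟫_ℂ = 0 := hMN.inner_eq hu hv
  have norm_add_sq : ‖u + v‖ ^ 2 = ‖u‖ ^ 2 + ‖v‖ ^ 2 := by
    simp only [sq]
    exact norm_add_sq_eq_norm_sq_add_norm_sq_of_inner_eq_zero u v inner_eq_zero
  rw [weyl_mul_weyl_of_im_eq_zero (by rw [inner_eq_zero, Complex.zero_im]),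
    hψ _ (L.add_mem (hM hu) (hN hv)), hψ _ (hM hu), hψ _ (hN hv), ← Complex.exp_add, norm_add_sq]
  congr 1
  push_cast
  ring

lemma IsVacuumVector.inner_amplify_list_prod (hψ : IsVacuumVector L ψ) {M : ℕ → Submodule ℂ K}
    (hML : ∀ k, M k ≤ L) (hM : Pairwise fun j k => M j ⟂ M k) {A : ℕ → Fock K →L[ℂ] Fock K}
    (hA : ∀ k, A k ∈ weylAlgebra (M k)) (n : ℕ) :
    ⟪ψ, amplify ((List.range n).map A).prod ψ⟫_ℂ =
      ∏ k ∈ Finset.range n, ⟪ψ, amplify (A k) ψ⟫_ℂ := by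
  induction n with
  | zero => simpa [weyl_zero] using hψ 0 L.zero_mem
  | succ n ih =>
    have prod_mem : ((List.range n).map A).prod ∈ weylAlgebra (⨆ k < n, M k) := by
      refine Subalgebra.list_prod_mem _ fun X hX => ?_
      obtain ⟨k, hk, rfl⟩ := List.mem_map.mp hX
      have le_iSup : M k ≤ ⨆ k < n, M k :=
        le_iSup₂ (f := fun k (_ : k < n) => M k) k (List.mem_range.mp hk)
      exact weylAlgebra_mono le_iSup (hA k)
    have isOrtho : (⨆ k < n, M k) ⟂ M n := by
      simp only [Submodule.isOrtho_iSup_left]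
      exact fun k hk => hM hk.ne
    rw [List.range_succ, List.map_append, List.prod_append, List.map_singleton,
      List.prod_singleton, hψ.inner_amplify_mul_of_mem_weylAlgebra (iSup₂_le fun k _ => hML k)
        (hML n) isOrtho prod_mem (hA n), ih, Finset.prod_range_succ]

/-- The vector of the Hilbert sum which corresponds to the exponential vector of `u` when `ψ`
corresponds to the Fock vacuum. -/
def coherentVec (ψ : Amplified ι (Fock K)) (u : K) : Amplified ι (Fock K) :=
  Complex.exp ((‖u‖ ^ 2 : ℝ) / 2) • amplify (weyl u) ψ

lemma coherentVec_zero : coherentVec ψ 0 = ψ := by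
  simp [coherentVec, weyl_zero, amplify_one]

lemma ofReal_norm_add_sq (u v : K) :
    ((‖u + v‖ ^ 2 : ℝ) : ℂ) = ‖u‖ ^ 2 + 2 * (⟪u, v⟫_ℂ).re + ‖v‖ ^ 2 := by
  rw [norm_add_sq (𝕜 := ℂ)]
  push_cast
  rfl

lemma amplify_weyl_coherentVec (u v : K) :
    amplify (weyl u) (coherentVec ψ v) =
      Complex.exp (-(‖u‖ ^ 2 : ℝ) / 2 - ⟪u, v⟫_ℂ) • coherentVec ψ (u + v) := by
  rw [coherentVec, coherentVec, map_smul, ← mul_apply_eq_comp, ← amplify_mul, weyl_mul_weyl,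
    amplify_smul, smul_apply, smul_smul, smul_smul, ← Complex.exp_add,
    ← Complex.exp_add, ofReal_norm_add_sq]
  congr 2
  push_cast
  linear_combination -Complex.re_add_im ⟪u, v⟫_ℂ

lemma IsVacuumVector.inner_coherentVec (hψ : IsVacuumVector L ψ) (u v : L) :
    ⟪coherentVec ψ u, coherentVec ψ v⟫_ℂ = Complex.exp ⟪u, v⟫_ℂ := by
  have inner_vacuum : ∀ w ∈ L, ⟪ψ, coherentVec ψ w⟫_ℂ = 1 := fun w hw => by
    rw [coherentVec, inner_smul_right, hψ w hw, ← Complex.exp_add, ← Complex.exp_zero]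
    congr 1
    ring
  rw [coherentVec, inner_smul_left, ← ContinuousLinearMap.adjoint_inner_right, adjoint_amplify,
    adjoint_weyl, amplify_weyl_coherentVec, inner_smul_right,
    inner_vacuum _ (L.add_mem (L.neg_mem u.2) v.2), mul_one, ← Complex.exp_conj,
    ← Complex.exp_add, norm_neg, inner_neg_left, Submodule.coe_inner]
  congr 1
  simp only [map_div₀, Complex.conj_ofReal, map_ofNat]
  ring

namespace IsVacuumVector

variable (hψ : IsVacuumVector L ψ)

/-- The isometric embedding of the Fock space of `L` which maps the vacuum to `ψ`. -/
def embedding : Fock L →ₗᵢ[ℂ] Amplified ι (Fock K) :=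
  fockLift (fun u : L => coherentVec ψ u) hψ.inner_coherentVec

lemma embedding_expVec (u : L) : hψ.embedding (expVec u) = coherentVec ψ u :=
  fockLift_expVec hψ.inner_coherentVec u

lemma embedding_expVec_zero : hψ.embedding (expVec 0) = ψ := by
  rw [embedding_expVec, ZeroMemClass.coe_zero, coherentVec_zero]

lemma inner_embedding_right (x : Fock L) : ⟪ψ, hψ.embedding x⟫_ℂ = ⟪expVec 0, x⟫_ℂ := by
  rw [← hψ.embedding.inner_map_map, embedding_expVec_zero]

lemma embedding_weyl (u : L) (x : Fock L) :
    hψ.embedding (weyl u x) = amplify (weyl (u : K)) (hψ.embedding x) := by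
  have comp_eq : hψ.embedding.toContinuousLinearMap ∘L weyl u =
      amplify (weyl (u : K)) ∘L hψ.embedding.toContinuousLinearMap := by
    refine fock_clm_ext fun v => ?_
    change hψ.embedding (weyl u (expVec v)) = amplify (weyl (u : K)) (hψ.embedding (expVec v))
    rw [weyl_expVec, map_smul, embedding_expVec, embedding_expVec, amplify_weyl_coherentVec]
    rfl
  exact congrArg (fun f => f x) comp_eq

lemma contract_embedding_mem_fieldOp_graph (b : HilbertBasis ι ℂ (Fock K)) (y : Fock K) {h : L}
    {x z : Fock L} (hx : (x, z) ∈ (fieldOp h).graph) :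
    (contract b y (hψ.embedding x), contract b y (hψ.embedding z)) ∈
      (fieldOp (h : K)).graph := by
  let contractEmbedding := contract b y ∘L hψ.embedding.toContinuousLinearMap
  have contractEmbedding_weyl (s : ℝ) : contractEmbedding (weyl (((s : ℂ) * I) • h) x) =
      weyl (((s : ℂ) * I) • (h : K)) (contractEmbedding x) := by
    change contract b y (hψ.embedding _) = weyl _ (contract b y (hψ.embedding x))
    rw [embedding_weyl, contract_amplify]
    rfl
  rw [fieldOp, mem_generator_graph] at hx ⊢
  have hasDerivAt := (contractEmbedding.restrictScalars ℝ).hasFDerivAt.comp_hasDerivAt 0 hx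
  refine (hasDerivAt.congr_deriv (map_smul contractEmbedding I z)).congr_of_eventuallyEq ?_
  exact .of_forall fun s => (contractEmbedding_weyl s).symm

end IsVacuumVector

end VacuumVectors

variable {ρ : Fock K →L[ℂ] Fock K}

lemma IsPurification.isVacuumVector {ι : Type} {Q : Fock K →L[ℂ] Fock K}
    {b : HilbertBasis ι ℂ (Fock K)} {ψ : Amplified ι (Fock K)} (hψ : IsPurification ρ Q b ψ)
    (hL : IsVacuumOn L ρ) : IsVacuumVector L ψ :=
  fun u hu => hψ.inner_amplify_eq (hL u hu)

lemma IsPurification.mem_fieldOp_graph {ι : Type} {Q : Fock K →L[ℂ] Fock K}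
    {b : HilbertBasis ι ℂ (Fock K)} {ψ : Amplified ι (Fock K)} (hψ : IsPurification ρ Q b ψ)
    (hL : IsVacuumVector L ψ) (h : L) (y : Fock K) :
    (ρ y, contract b (Q y) (hL.embedding (creationVec h 0))) ∈ (fieldOp (h : K)).graph := by
  have mem_graph :=
    hL.contract_embedding_mem_fieldOp_graph b (Q y) (expVec_mem_fieldOp_graph h 0)
  rwa [hL.embedding_expVec_zero, hψ.contract_map_eq, fieldVec_zero] at mem_graph

namespace IsVacuumOn

variable (hL : IsVacuumOn L ρ)

include hL

lemma isJointlyGaussian_fieldOp {κ : Type} [Fintype κ] {η : κ → K} (hη : ∀ a, η a ∈ L) :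
    IsJointlyGaussian ρ (fun a => fieldOp (η a)) 0 (Matrix.gram ℂ η) := by
  have inner_eq (u v : κ → ℝ) :
      ⟪I • ∑ a, (u a : ℂ) • η a, I • ∑ a, (v a : ℂ) • η a⟫_ℂ =
        ∑ a, ∑ b, (u a : ℂ) * Matrix.gram ℂ η a b * (v b : ℂ) := by
    simp only [inner_smul_left, inner_smul_right, sum_inner, inner_sum, Matrix.gram_apply,
      Complex.conj_ofReal, Complex.conj_I, Finset.mul_sum]
    rw [Finset.sum_comm]
    refine Finset.sum_congr rfl fun a _ => Finset.sum_congr rfl fun b _ => ?_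
    linear_combination (-(u a : ℂ) * ⟪η a, η b⟫_ℂ * v b) * Complex.I_mul_I
  refine ⟨fun u v => ?_, fun u => ?_⟩
  · have inner_im : ((⟪I • ∑ a, (u a : ℂ) • η a, I • ∑ a, (v a : ℂ) • η a⟫_ℂ).im : ℂ) =
        ∑ a, ∑ b, (u a : ℂ) * ((Matrix.gram ℂ η a b).im : ℂ) * (v b : ℂ) := by
      rw [inner_eq]
      simp only [Complex.im_sum, Complex.im_mul_ofReal, Complex.im_ofReal_mul, Complex.ofReal_sum,
        Complex.ofReal_mul]
    simp only [expI_linComb_fieldOp, weyl_mul_weyl, inner_im, Pi.add_apply, Complex.ofReal_add,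
      add_smul, Finset.sum_add_distrib, smul_add]
  · have mem : I • ∑ a, (u a : ℂ) • η a ∈ L :=
      L.smul_mem _ (L.sum_mem fun a _ => L.smul_mem _ (hη a))
    have exponent_eq : (-(‖I • ∑ a, (u a : ℂ) • η a‖ ^ 2 : ℝ) / 2 : ℂ) =
        I * (∑ a, (u a : ℂ) * ((0 : κ → ℝ) a : ℂ)) -
          1 / 2 * ∑ a, ∑ b, (u a : ℂ) * Matrix.gram ℂ η a b * (u b : ℂ) := by
      rw [← inner_eq, inner_self_eq_norm_sq_to_K]
      simp
      ring
    rw [expI_linComb_fieldOp]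
    simpa only [exponent_eq] using hL _ mem

variable (hρ : IsDensityOperator ρ)

include hρ

lemma hasExpectation_fieldOp {h : K} (hh : h ∈ L) : HasExpectation ρ (fieldOp h) 0 := by
  obtain ⟨ι, b, Q, ψ, hψ⟩ := hρ.exists_purification
  have hψL := hψ.isVacuumVector hL
  lift h to L using hh
  have inner_eq_zero : ⟪ψ, hψL.embedding (creationVec h 0)⟫_ℂ = 0 := by
    rw [hψL.inner_embedding_right, inner_creationVec_right, inner_zero_left, zero_mul]
  rw [← inner_eq_zero]
  exact hψ.hasExpectation (hψ.mem_fieldOp_graph hψL h)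

lemma hasExpectation_opMul_fieldOp {g h : K} (hg : g ∈ L) (hh : h ∈ L) :
    HasExpectation ρ (opMul (fieldOp g) (fieldOp h)) ⟪g, h⟫_ℂ := by
  obtain ⟨ι, b, Q, ψ, hψ⟩ := hρ.exists_purification
  have hψL := hψ.isVacuumVector hL
  lift g to L using hg
  lift h to L using hh
  obtain ⟨z, hz⟩ := LinearPMap.mem_domain_iff.mp (creationVec_mem_fieldOp_domain h g 0)
  have inner_eq : ⟪ψ, hψL.embedding z⟫_ℂ = ⟪(g : K), (h : K)⟫_ℂ := by
    have inner_graph := (isUnitaryGroup_weyl g).inner_graph hz (expVec_mem_fieldOp_graph g 0)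
    rw [fieldVec_zero, inner_creationVec_creationVec] at inner_graph
    rw [hψL.inner_embedding_right, ← inner_graph, Submodule.coe_inner]
    simp
  rw [← inner_eq]
  exact hψ.hasExpectation fun y => mem_opMul_graph (hψ.mem_fieldOp_graph hψL h y)
    (hψL.contract_embedding_mem_fieldOp_graph b (Q y) hz)

lemma statIndependent_fieldOp {κ : Type} [Fintype κ] {η : ℕ → κ → K} (hη : ∀ k a, η k a ∈ L)
    (orthogonal : ∀ j k, j ≠ k → ∀ a b, ⟪η j a, η k b⟫_ℂ = 0) :
    StatIndependent ρ fun k a => fieldOp (η k a) := by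
  obtain ⟨ι, b, Q, ψ, hψ⟩ := hρ.exists_purification
  let M (k : ℕ) : Submodule ℂ K := Submodule.span ℂ (Set.range (η k))
  have le (k : ℕ) : M k ≤ L := Submodule.span_le.mpr (Set.range_subset_iff.mpr (hη k))
  have pairwise_isOrtho : Pairwise fun j k => M j ⟂ M k := by
    intro j k hjk
    rw [Submodule.isOrtho_span]
    rintro _ ⟨a, rfl⟩ _ ⟨b, rfl⟩
    exact orthogonal j k hjk a b
  have subset (k : ℕ) : generatedAlgebra (fun a => fieldOp (η k a)) ⊆ weylAlgebra (M k) :=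
    generatedAlgebra_fieldOp_subset fun a => Submodule.subset_span (Set.mem_range_self a)
  refine ⟨fun j k hjk A hA B hB => commute_of_mem_weylAlgebra (pairwise_isOrtho hjk)
    (subset j hA) (subset k hB), fun N A hA => ?_⟩
  refine ⟨fun k => ⟪ψ, amplify (A k) ψ⟫_ℂ, fun k => hψ.hasExpectation_ofBounded (A k), ?_⟩
  rw [← (hψ.isVacuumVector hL).inner_amplify_list_prod le pairwise_isOrtho
    fun k => subset k (hA k)]
  exact hψ.hasExpectation_ofBounded _

end IsVacuumOn

end VacuumStates

/-! ### The one-particle vectors of the Karhunen-Loeve coefficients -/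

section Integration

open Set

variable {E : Type*} [NormedAddCommGroup E]

lemma setIntegral_Icc_integral_Icc_swap [NormedSpace ℝ E] {a b : ℝ} {f : ℝ → ℝ → E}
    (hf : Integrable f.uncurry ((volume.restrict (Icc a b)).prod (volume.restrict (Icc a b)))) :
    ∫ t in Icc a b, ∫ s in Icc a t, f t s = ∫ s in Icc a b, ∫ t in Icc s b, f t s := by
  have triangle_measurable : MeasurableSet {p : ℝ × ℝ | p.2 ≤ p.1} :=
    measurableSet_le measurable_snd measurable_fst
  have inner_s : ∀ t ∈ Icc a b, ∫ s in Icc a t, f t s = ∫ s in Icc a b,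
      {p : ℝ × ℝ | p.2 ≤ p.1}.indicator f.uncurry (t, s) := fun t ht => by
    have slice : Icc a t = Icc a b ∩ Iic t := by grind
    rw [slice, ← setIntegral_indicator measurableSet_Iic]
    rfl
  have inner_t : ∀ s ∈ Icc a b, ∫ t in Icc s b, f t s = ∫ t in Icc a b,
      {p : ℝ × ℝ | p.2 ≤ p.1}.indicator f.uncurry (t, s) := fun s hs => by
    have slice : Icc s b = Icc a b ∩ Ici s := by grind
    rw [slice, ← setIntegral_indicator measurableSet_Ici]
    rfl
  rw [setIntegral_congr_fun measurableSet_Icc inner_s,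
    setIntegral_congr_fun measurableSet_Icc inner_t]
  exact integral_integral_swap (hf.indicator triangle_measurable)

variable {X : Type*} [TopologicalSpace X] [T2Space X]
  [MeasurableSpace X] [OpensMeasurableSpace X] {μ : Measure X} [IsFiniteMeasureOnCompacts μ]

lemma memLp_restrict_of_continuousOn {f : X → E} {K : Set X} (hf : ContinuousOn f K)
    (hK : IsCompact K) (p : ENNReal) : MemLp f p (μ.restrict K) := by
  have : IsFiniteMeasure (μ.restrict K) :=
    isFiniteMeasure_restrict.mpr hK.measure_lt_top.ne
  obtain ⟨C, hC⟩ := hK.exists_bound_of_continuousOn hf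
  exact .of_bound (hf.aestronglyMeasurable_of_isCompact hK hK.measurableSet) C
    (ae_restrict_of_forall_mem hK.measurableSet hC)

end Integration

section BandVectors

open Set

variable {d : ℕ}

lemma complexForm_smul (r : ℝ) (x : EuclideanSpace ℝ (Fin 2 × Fin d)) :
    complexForm (r • x) = r • complexForm x := by
  ext j
  simp only [complexForm, PiLp.smul_apply, smul_eq_mul, Complex.ofReal_mul, Complex.real_smul]
  ring

lemma complexForm_zero : complexForm (0 : EuclideanSpace ℝ (Fin 2 × Fin d)) = 0 := by
  simpa only [zero_smul] using complexForm_smul 0 (0 : EuclideanSpace ℝ (Fin 2 × Fin d))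

lemma complexForm_indicator (s : Set ℝ) (f : ℝ → EuclideanSpace ℝ (Fin 2 × Fin d)) :
    (fun t => complexForm (s.indicator f t)) = s.indicator fun t => complexForm (f t) :=
  indicator_comp_of_zero complexForm_zero |>.symm

/-- The vector of `ℂᵈ` representing the unit vector `e_a` of the channel `a`: a unit vector for a
position-type channel and `i` times a unit vector for a momentum-type one. -/
def channel (a : Fin 2 × Fin d) : EuclideanSpace ℂ (Fin d) :=
  complexForm (EuclideanSpace.single a 1)

lemma channel_eq_single (a : Fin 2 × Fin d) :
    channel a = EuclideanSpace.single a.2 (if a.1 = 0 then 1 else I) := by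
  obtain ⟨i, j⟩ := a
  ext l
  fin_cases i <;> by_cases hl : l = j <;> simp [channel, complexForm, hl]

lemma inner_channel (a b : Fin 2 × Fin d) : ⟪channel a, channel b⟫_ℂ = Omega d a b := by
  obtain ⟨i, j⟩ := a
  obtain ⟨i', j'⟩ := b
  simp only [channel_eq_single, EuclideanSpace.inner_single_left, Omega, J, bJ]
  by_cases hj : j = j' <;> fin_cases i <;> fin_cases i' <;> simp [hj]

/-- The one-particle vector of the function `φ e_a` on `[0, T]`, which is sensible when `φ` is
square integrable there. -/
def bandVec (T : ℝ) (φ : ℝ → ℝ) (a : Fin 2 × Fin d) : OneParticle d :=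
  testVec ((Icc 0 T).indicator fun s => φ s • EuclideanSpace.single a 1)

lemma restrict_Ici_restrict_Icc (T : ℝ) :
    (volume.restrict (Ici (0 : ℝ))).restrict (Icc 0 T) = volume.restrict (Icc 0 T) :=
  Measure.restrict_restrict_of_subset Icc_subset_Ici_self

variable {S T : ℝ} {φ χ : ℝ → ℝ}

lemma coeFn_bandVec (hφ : MemLp φ 2 (volume.restrict (Icc 0 T))) (a : Fin 2 × Fin d) :
    bandVec T φ a =ᵐ[volume.restrict (Ici 0)] (Icc 0 T).indicator fun s => φ s • channel a := by
  have complexForm_band : (fun t => complexForm ((Icc 0 T).indicator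
      (fun s => φ s • EuclideanSpace.single a (1 : ℝ)) t)) =
      (Icc 0 T).indicator fun s => φ s • channel a := by
    simp only [complexForm_indicator, complexForm_smul, channel]
  have band_memLp : MemLp ((Icc 0 T).indicator fun s => φ s • channel a) 2
      (volume.restrict (Ici 0)) := by
    rw [memLp_indicator_iff_restrict measurableSet_Icc, restrict_Ici_restrict_Icc]
    exact (ContinuousLinearMap.toSpanSingleton ℝ (channel a)).comp_memLp' hφ
  rw [← complexForm_band] at band_memLp ⊢
  rw [bandVec, testVec, dif_pos band_memLp]
  exact band_memLp.coeFn_toLp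

lemma inner_bandVec (w : OneParticle d) (hφ : MemLp φ 2 (volume.restrict (Icc 0 T)))
    (a : Fin 2 × Fin d) :
    ⟪w, bandVec T φ a⟫_ℂ = ∫ s in Icc 0 T, φ s • ⟪w s, channel a⟫_ℂ := by
  rw [L2.inner_def, ← restrict_Ici_restrict_Icc, ← integral_indicator measurableSet_Icc]
  refine integral_congr_ae ?_
  filter_upwards [coeFn_bandVec hφ a] with s hs
  rw [hs]
  by_cases hsT : s ∈ Icc 0 T
  · rw [indicator_of_mem hsT, indicator_of_mem hsT, inner_smul_right_eq_smul]
  · rw [indicator_of_notMem hsT, indicator_of_notMem hsT, inner_zero_right]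

lemma inner_bandVec_bandVec (hφ : MemLp φ 2 (volume.restrict (Icc 0 S)))
    (hχ : MemLp χ 2 (volume.restrict (Icc 0 T))) (a b : Fin 2 × Fin d) :
    ⟪bandVec S φ a, bandVec T χ b⟫_ℂ =
      (∫ s in Icc 0 (min S T), φ s * χ s : ℝ) • Omega d a b := by
  have inner_ae : ∀ᵐ s ∂volume.restrict (Icc 0 T), χ s • ⟪bandVec S φ a s, channel b⟫_ℂ =
      (Icc 0 S).indicator (fun s => (φ s * χ s) • Omega d a b) s := by
    rw [← restrict_Ici_restrict_Icc]
    filter_upwards [ae_restrict_of_ae (coeFn_bandVec hφ a)] with s hs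
    rw [hs]
    by_cases hsS : s ∈ Icc 0 S
    · rw [indicator_of_mem hsS, indicator_of_mem hsS, inner_smul_left_eq_smul, inner_channel,
        smul_smul, mul_comm]
    · rw [indicator_of_notMem hsS, indicator_of_notMem hsS, inner_zero_left, smul_zero]
  rw [inner_bandVec _ hχ, integral_congr_ae inner_ae, setIntegral_indicator measurableSet_Icc,
    Icc_inter_Icc, sup_idem, inf_comm, integral_smul_const]

lemma memLp_one_Icc (T : ℝ) : MemLp (fun _ => 1 : ℝ → ℝ) 2 (volume.restrict (Icc 0 T)) :=
  memLp_const 1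

lemma continuous_bandVec_one (a : Fin 2 × Fin d) :
    Continuous fun t => bandVec t (fun _ => 1) a := by
  refine continuous_of_continuous_inner (𝕜 := ℂ) ?_
  have inner_eq (p : ℝ × ℝ) : ⟪bandVec p.1 (fun _ => 1) a, bandVec p.2 (fun _ => 1) a⟫_ℂ =
      max (min p.1 p.2) 0 • Omega d a a := by
    rw [inner_bandVec_bandVec (memLp_one_Icc _) (memLp_one_Icc _)]
    simp [Real.volume_real_Icc]
  simp only [inner_eq]
  fun_prop

lemma W_sub_idOp (a : Fin 2 × Fin d) (t : ℝ) :
    W a t - idOp d = fieldOp (bandVec t (fun _ => 1) a) := by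
  simp only [W, idOp, ofBounded_add_sub_ofBounded, wienerIntegral, bandVec, one_smul]

lemma integrableOn_inner_channel (w : OneParticle d) (T : ℝ) (a : Fin 2 × Fin d) :
    IntegrableOn (fun s => ⟪w s, channel a⟫_ℂ) (Icc 0 T) := by
  have w_memLp := (Lp.memLp w).restrict (Icc 0 T)
  rw [restrict_Ici_restrict_Icc] at w_memLp
  exact (w_memLp.integrable one_le_two).inner_const _

-- Integration by parts: both sides are the integral of `φ t • e_a` over `0 ≤ s ≤ t ≤ T`.
lemma integral_smul_bandVec_one (hT : 0 ≤ T) (hφ : IntegrableOn φ (Icc 0 T))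
    (a : Fin 2 × Fin d) : ∫ t in Icc 0 T, φ t • bandVec t (fun _ => 1) a =
      bandVec T (fun s => ∫ t in s..T, φ t) a := by
  have primitive_memLp : MemLp (fun s => ∫ t in s..T, φ t) 2 (volume.restrict (Icc 0 T)) := by
    rw [← uIcc_of_le hT] at hφ ⊢
    exact memLp_restrict_of_continuousOn
      (intervalIntegral.continuousOn_primitive_interval_left hφ) isCompact_uIcc 2
  have band_integrable : IntegrableOn (fun t => φ t • bandVec t (fun _ => 1) a) (Icc 0 T) :=
    hφ.smul_continuousOn (continuous_bandVec_one a).continuousOn isCompact_Icc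
  refine ext_inner_left ℂ fun w => ?_
  calc ⟪w, ∫ t in Icc 0 T, φ t • bandVec t (fun _ => 1) a⟫_ℂ
      = ∫ t in Icc 0 T, ∫ s in Icc 0 t, φ t • ⟪w s, channel a⟫_ℂ := by
        rw [← integral_inner band_integrable]
        simp only [inner_smul_right_eq_smul, inner_bandVec w (memLp_one_Icc _), one_smul,
          integral_smul]
    _ = ∫ s in Icc 0 T, ∫ t in Icc s T, φ t • ⟪w s, channel a⟫_ℂ :=
        setIntegral_Icc_integral_Icc_swap (hφ.smul_prod (integrableOn_inner_channel w T a))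
    _ = ∫ s in Icc 0 T, (∫ t in s..T, φ t) • ⟪w s, channel a⟫_ℂ :=
        setIntegral_congr_fun measurableSet_Icc fun s hs => by
          rw [integral_smul_const, integral_Icc_eq_integral_Ioc,
            intervalIntegral.integral_of_le hs.2]
    _ = ⟪w, bandVec T (fun s => ∫ t in s..T, φ t) a⟫_ℂ := (inner_bandVec w primitive_memLp a).symm

end BandVectors

section KarhunenLoeve

open Set

variable {d : ℕ} {T : ℝ}

/-- The function `√(2 / T) cos (ω_k t)`, which is `ω_k ∫ s in t..T, f_k(s)`. -/
def cosfun (T : ℝ) (k : ℕ) (t : ℝ) : ℝ := √(2 / T) * Real.cos (omega T k * t)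

lemma continuous_cosfun (T : ℝ) (k : ℕ) : Continuous (cosfun T k) := by
  unfold cosfun
  fun_prop

lemma memLp_cosfun (T : ℝ) (k : ℕ) : MemLp (cosfun T k) 2 (volume.restrict (Icc 0 T)) :=
  memLp_restrict_of_continuousOn (continuous_cosfun T k).continuousOn isCompact_Icc 2

lemma continuous_eigenfun (T : ℝ) (k : ℕ) : Continuous (eigenfun T k) := by
  unfold eigenfun
  fun_prop

lemma omega_pos (hT : 0 < T) (k : ℕ) : 0 < omega T k := by
  unfold omega
  positivity

lemma cos_omega_mul (hT : T ≠ 0) (k : ℕ) : Real.cos (omega T k * T) = 0 :=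
  Real.cos_eq_zero_iff.mpr ⟨k, by unfold omega; push_cast; field_simp⟩

lemma integral_omega_mul_eigenfun (hT : T ≠ 0) (k : ℕ) (s : ℝ) :
    ∫ t in s..T, omega T k * eigenfun T k t = cosfun T k s := by
  have hasDerivAt_cosfun (t : ℝ) :
      HasDerivAt (fun t => -cosfun T k t) (omega T k * eigenfun T k t) t := by
    refine (((((hasDerivAt_id t).const_mul (omega T k)).cos).const_mul √(2 / T)).neg).congr_deriv ?_
    simp only [id, eigenfun]
    ring
  rw [intervalIntegral.integral_eq_sub_of_hasDerivAt (fun t _ => hasDerivAt_cosfun t)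
      ((continuous_const.mul (continuous_eigenfun T k)).intervalIntegrable _ _)]
  simp [cosfun, cos_omega_mul hT]

lemma integral_cos_int_mul_pi_div (hT : T ≠ 0) {n : ℤ} (hn : n ≠ 0) :
    ∫ t in 0..T, Real.cos (n * Real.pi / T * t) = 0 := by
  have frequency_ne_zero : n * Real.pi / T ≠ 0 :=
    div_ne_zero (mul_ne_zero (Int.cast_ne_zero.mpr hn) Real.pi_ne_zero) hT
  rw [intervalIntegral.integral_comp_mul_left Real.cos frequency_ne_zero, integral_cos,
    div_mul_cancel₀ _ hT, Real.sin_int_mul_pi, mul_zero, Real.sin_zero, sub_zero, smul_zero]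

lemma cosfun_mul_cosfun (hT : 0 ≤ T) (j k : ℕ) (s : ℝ) :
    cosfun T j s * cosfun T k s = T⁻¹ * (Real.cos ((j - k : ℤ) * Real.pi / T * s) +
      Real.cos ((j + k + 1 : ℤ) * Real.pi / T * s)) := by
  have difference : (j - k : ℤ) * Real.pi / T * s = omega T j * s - omega T k * s := by
    simp only [omega]
    push_cast
    ring
  have sum : (j + k + 1 : ℤ) * Real.pi / T * s = omega T j * s + omega T k * s := by
    simp only [omega]
    push_cast
    ring
  have amplitude : √(2 / T) * √(2 / T) = 2 * T⁻¹ := by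
    rw [Real.mul_self_sqrt (by positivity), div_eq_mul_inv]
  rw [difference, sum, Real.cos_sub, Real.cos_add, cosfun, cosfun]
  linear_combination (Real.cos (omega T j * s) * Real.cos (omega T k * s)) * amplitude

lemma integral_cosfun_mul_cosfun (hT : 0 < T) (j k : ℕ) :
    ∫ s in Icc 0 T, cosfun T j s * cosfun T k s = if j = k then 1 else 0 := by
  have integrable (n : ℤ) :
      IntervalIntegrable (fun s => Real.cos (n * Real.pi / T * s)) volume 0 T :=
    (by fun_prop : Continuous _).intervalIntegrable _ _
  simp only [integral_Icc_eq_integral_Ioc, ← intervalIntegral.integral_of_le hT.le,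
    cosfun_mul_cosfun hT.le]
  rw [intervalIntegral.integral_const_mul, intervalIntegral.integral_add (integrable _)
    (integrable _), integral_cos_int_mul_pi_div hT.ne' (n := j + k + 1) (by positivity), add_zero]
  split_ifs with hjk
  · simp [hjk, hT.ne']
  · rw [integral_cos_int_mul_pi_div hT.ne' (by omega), mul_zero]

/-- The one-particle vector `√(2 / T) cos (ω_k t) e_a` on `[0, T]`, whose field operator is the
component `a` of the Karhunen-Loeve coefficient `w_k`. -/
def klVec (T : ℝ) (k : ℕ) (a : Fin 2 × Fin d) : OneParticle d := bandVec T (cosfun T k) a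

lemma omega_smul_integral_eigenfun (hT : 0 < T) (k : ℕ) (a : Fin 2 × Fin d) :
    omega T k • ∫ t in Icc 0 T, eigenfun T k t • bandVec t (fun _ => 1) a = klVec T k a := by
  have weight_integrable : IntegrableOn (fun t => omega T k * eigenfun T k t) (Icc 0 T) :=
    (continuous_const.mul (continuous_eigenfun T k)).integrableOn_Icc
  simp only [← integral_smul, smul_smul, integral_smul_bandVec_one hT.le weight_integrable,
    integral_omega_mul_eigenfun hT.ne', klVec]

lemma klCoeff_eq_fieldOp (hT : 0 < T) (k : ℕ) (a : Fin 2 × Fin d) :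
    klCoeff T k a = fieldOp (klVec T k a) := by
  have band_integrable :
      IntegrableOn (fun t => eigenfun T k t • bandVec t (fun _ => 1) a) (Icc 0 T) :=
    ((continuous_eigenfun T k).smul (continuous_bandVec_one a)).integrableOn_Icc
  rw [klCoeff, strongIntegral_fieldOp band_integrable fun t _ => W_sub_idOp a t,
    smul_fieldOp (omega_pos hT k).ne', Complex.coe_smul]
  exact congrArg fieldOp (omega_smul_integral_eigenfun hT k a)

lemma inner_klVec (hT : 0 < T) (j k : ℕ) (a b : Fin 2 × Fin d) :
    ⟪klVec T j a, klVec T k b⟫_ℂ = if j = k then Omega d a b else 0 := by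
  rw [klVec, klVec, inner_bandVec_bandVec (memLp_cosfun T j) (memLp_cosfun T k), min_self,
    integral_cosfun_mul_cosfun hT, ite_smul, one_smul, zero_smul]

lemma gram_klVec (hT : 0 < T) (n : ℕ) :
    Matrix.gram ℂ (fun p : Fin n × (Fin 2 × Fin d) => klVec T p.1 p.2) = 1 ⊗ₖ Omega d := by
  ext p q
  simp only [Matrix.gram_apply, inner_klVec hT, Matrix.kroneckerMap_apply, Matrix.one_apply,
    Fin.ext_iff, ite_mul, one_mul, zero_mul]

end KarhunenLoeve

section WienerVacuum

open Set

lemma norm_sq_eq_integral_norm_sq {X F : Type*} [MeasurableSpace X] {μ : Measure X}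
    [NormedAddCommGroup F] [InnerProductSpace ℂ F] (u : Lp F 2 μ) :
    ‖u‖ ^ 2 = ∫ x, ‖u x‖ ^ 2 ∂μ := by
  have inner_eq : ⟪u, u⟫_ℂ = ∫ x, ⟪u x, u x⟫_ℂ ∂μ := L2.inner_def u u
  simp only [inner_self_eq_norm_sq_to_K, Complex.coe_algebraMap] at inner_eq
  exact_mod_cast inner_eq

variable {d : ℕ} {T : ℝ} {u : OneParticle d}

/-- The vector of `ℝᵐ`, `m = 2 d`, with a given complex form: the inverse of `complexForm`. -/
def realForm (z : EuclideanSpace ℂ (Fin d)) : EuclideanSpace ℝ (Fin 2 × Fin d) :=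
  WithLp.toLp 2 fun p => if p.1 = 0 then (z p.2).re else (z p.2).im

lemma complexForm_realForm (z : EuclideanSpace ℂ (Fin d)) : complexForm (realForm z) = z := by
  ext j
  simp [complexForm, realForm, mul_comm I, Complex.re_add_im]

lemma norm_realForm (z : EuclideanSpace ℂ (Fin d)) : ‖realForm z‖ = ‖z‖ := by
  rw [← sq_eq_sq₀ (norm_nonneg _) (norm_nonneg _), EuclideanSpace.norm_sq_eq,
    EuclideanSpace.norm_sq_eq, Fintype.sum_prod_type_right]
  refine Finset.sum_congr rfl fun j _ => ?_
  rw [Fin.sum_univ_two, ← Complex.normSq_eq_norm_sq, Complex.normSq_apply]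
  simp [realForm, sq]

lemma continuous_realForm : Continuous (realForm (d := d)) := by
  refine (PiLp.continuous_toLp 2 _).comp (continuous_pi fun p => ?_)
  split_ifs <;> fun_prop

/-- The closed subspace of the one-particle vectors which vanish outside `[0, T]`: the ones whose
field operators are the stochastic integrals `∫ fᵀ dW` over `[0, T]`. -/
def supported (d : ℕ) (T : ℝ) : Submodule ℂ (OneParticle d) where
  carrier := {u | ∀ᵐ t ∂volume.restrict (Ici (0 : ℝ)), t ∉ Icc 0 T → u t = 0}
  add_mem' {u v} hu hv := by
    filter_upwards [hu, hv, Lp.coeFn_add u v] with t hut hvt hadd ht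
    rw [hadd, Pi.add_apply, hut ht, hvt ht, add_zero]
  zero_mem' := by
    filter_upwards [Lp.coeFn_zero (E := EuclideanSpace ℂ (Fin d)) 2
      (volume.restrict (Ici (0 : ℝ)))] with t hzero _
    rw [hzero, Pi.zero_apply]
  smul_mem' c u hu := by
    filter_upwards [hu, Lp.coeFn_smul c u] with t hut hsmul ht
    rw [hsmul, Pi.smul_apply, hut ht, smul_zero]

lemma bandVec_mem_supported {φ : ℝ → ℝ} (hφ : MemLp φ 2 (volume.restrict (Icc 0 T)))
    (a : Fin 2 × Fin d) : bandVec T φ a ∈ supported d T := by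
  change ∀ᵐ t ∂volume.restrict (Ici (0 : ℝ)), t ∉ Icc 0 T → bandVec T φ a t = 0
  filter_upwards [coeFn_bandVec hφ a] with t hband ht
  rw [hband, indicator_of_notMem ht]

lemma klVec_mem_supported (T : ℝ) (k : ℕ) (a : Fin 2 × Fin d) : klVec T k a ∈ supported d T :=
  bandVec_mem_supported (memLp_cosfun T k) a

lemma indicator_ae_eq_of_mem_supported (hu : u ∈ supported d T) :
    (Icc 0 T).indicator u =ᵐ[volume.restrict (Ici 0)] u := by
  filter_upwards [hu] with t hut
  exact indicator_apply_eq_self.mpr hut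

lemma memLp_realForm (u : OneParticle d) (T : ℝ) :
    MemLp (fun t => realForm (u t)) 2 (volume.restrict (Icc 0 T)) := by
  have u_memLp := (Lp.memLp u).restrict (Icc 0 T)
  rw [restrict_Ici_restrict_Icc] at u_memLp
  exact u_memLp.of_le (continuous_realForm.comp_aestronglyMeasurable u_memLp.aestronglyMeasurable)
    (.of_forall fun t => (norm_realForm (u t)).le)

lemma testVec_indicator_realForm (hu : u ∈ supported d T) :
    testVec ((Icc 0 T).indicator fun t => realForm (u t)) = u := by
  have complexForm_ae_eq : (fun t => complexForm ((Icc 0 T).indicator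
      (fun t => realForm (u t)) t)) =ᵐ[volume.restrict (Ici 0)] u := by
    simpa only [complexForm_indicator, complexForm_realForm] using
      indicator_ae_eq_of_mem_supported hu
  have complexForm_memLp := (memLp_congr_ae complexForm_ae_eq).mpr (Lp.memLp u)
  rw [testVec, dif_pos complexForm_memLp]
  exact Lp.ext (complexForm_memLp.coeFn_toLp.trans complexForm_ae_eq)

lemma integral_norm_sq_realForm (hu : u ∈ supported d T) :
    ∫ t in Icc 0 T, ‖realForm (u t)‖ ^ 2 = ‖u‖ ^ 2 := by
  rw [norm_sq_eq_integral_norm_sq, ← restrict_Ici_restrict_Icc,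
    ← integral_indicator measurableSet_Icc]
  refine integral_congr_ae ?_
  filter_upwards [indicator_ae_eq_of_mem_supported hu] with t hut
  rw [← hut]
  by_cases ht : t ∈ Icc 0 T <;> simp [ht, norm_realForm]

lemma IsVacuum.isVacuumOn {ρ : FieldSpace d →L[ℂ] FieldSpace d} (h : IsVacuum T ρ) :
    IsVacuumOn (supported d T) ρ := by
  intro u hu
  have rotated_mem : (-I) • u ∈ supported d T := (supported d T).smul_mem (-I) hu
  have expI_eq : expI (wienerIntegral T fun t => realForm (((-I) • u : OneParticle d) t)) =
      weyl u := by
    rw [wienerIntegral, testVec_indicator_realForm rotated_mem, expI_fieldOp, smul_smul]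
    simp
  have norm_eq : ‖(-I) • u‖ = ‖u‖ := by simp [norm_smul]
  have expectation := h _ (memLp_realForm ((-I) • u) T)
  rw [expI_eq, integral_norm_sq_realForm rotated_mem, norm_eq] at expectation
  rwa [neg_div, ← one_div_mul_eq_div, ← neg_mul]

end WienerVacuum

end QKL

end

theorem theorem1 (d : ℕ) (T : ℝ) (hT : 0 < T)
    (ρ : QKL.FieldSpace d →L[ℂ] QKL.FieldSpace d) (hρ : QKL.IsDensityOperator ρ)
    (hvac : QKL.IsVacuum T ρ) :
    QKL.StatIndependent ρ (QKL.klCoeff T) ∧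
    (∀ N : ℕ, QKL.IsJointlyGaussian ρ
      (fun p : Fin (N + 1) × (Fin 2 × Fin d) => QKL.klCoeff T (p.1 : ℕ) p.2) 0
      ((1 : Matrix (Fin (N + 1)) (Fin (N + 1)) ℂ) ⊗ₖ QKL.Omega d)) ∧
    (∀ (k : ℕ) (a : Fin 2 × Fin d), QKL.HasExpectation ρ (QKL.klCoeff T k a) 0) ∧
    (∀ (j k : ℕ) (a b : Fin 2 × Fin d),
      QKL.HasExpectation ρ (QKL.opMul (QKL.klCoeff T j a) (QKL.klCoeff T k b))
        (if j = k then QKL.Omega d a b else 0)) := by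
  have hkl : QKL.klCoeff (d := d) T = fun k a => QKL.fieldOp (QKL.klVec T k a) :=
    funext fun k => funext fun a => QKL.klCoeff_eq_fieldOp hT k a
  have hη (k : ℕ) (a : Fin 2 × Fin d) : QKL.klVec T k a ∈ QKL.supported d T :=
    QKL.klVec_mem_supported T k a
  have hL : QKL.IsVacuumOn (QKL.supported d T) ρ := hvac.isVacuumOn
  rw [hkl]
  refine ⟨hL.statIndependent_fieldOp hρ hη fun j k hjk a b => ?_, fun N => ?_,
    fun k a => hL.hasExpectation_fieldOp hρ (hη k a), fun j k a b => ?_⟩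
  · rw [QKL.inner_klVec hT, if_neg hjk]
  · rw [← QKL.gram_klVec hT]
    exact hL.isJointlyGaussian_fieldOp fun p => hη p.1 p.2
  · rw [← QKL.inner_klVec hT]
    exact hL.hasExpectation_opMul_fieldOp hρ (hη j a) (hη k b)
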